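/- **Setting.** Let $n\ge 1$ and let $P$ be a polygon with $n+3$ vertices, given in cyclic order as $f,\,p_0=i,\,p_1,\dots,p_n,\,p_{n+1}=j$. Let $\Delta$ be the fan triangulation with diagonals $fp_1,\dots,fp_n$ and triangles $fp_kp_{k+1}$ ($0\le k\le n$), and let $\gamma=i\to j$ be the longest directed edge. (Since $P$ may be numbered in either cyclic sense, $\gamma$ is either one of the two longest directed edges.) To each edge $ab$ of a triangulation (boundary edges included) belong two variables, the directed edges $x_{a\to b}$ (on the node closest to $a$) and $x_{b\to a}$; to each triangle $abc$ belongs one face variable $x_{abc}$. The variables on boundary edges are frozen, all others are mutable. The quiver of the triangulation ($3$-triangulation quiver) has these as nodes; a triangle with vertices $a,b,c$ in counterclockwise order contains the clockwise $3$-cycle $abc\;\to\;(a\to b)\;\to\;(a\to c)\;\to\;abc$ and the two $3$-cycles obtained from it by rotating $a,b,c$ (parallel arrows are added with sign, opposite arrows cancel). The seed of $\Delta$ consists of this quiver and independent indeterminates, in the field of rational functions over $\mathbb Q$ in the initial variables. The flip of a diagonal $ac$ with adjacent triangles $abc$, $acd$ mutates at $a\to c$ and $c\to a$, then at $abc$ and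 $acd$; afterwards these four nodes carry $x_{abd},x_{bcd},x_{b\to d},x_{d\to b}$ respectively. For mutable $u$ put $\hat y_u=\prod_{v\to u}x_v\big/\prod_{u\to v}x_v$, computed in the seed of $\Delta$. On the Laurent monomials occurring in the expansion of $x_\gamma$ in the initial variables consider the order generated by $x_M<x_{M'}$ whenever $x_{M'}=\hat y_u\,x_M$ for some mutable $u$, if $f,i,p_1,\dots,p_n,j$ is the counterclockwise order of the vertices; if it is the clockwise order, use $\hat y_u^{-1}$ in place of $\hat y_u$. Call the result the expansion poset $\mathbb T_\gamma$. Let $L$ be the lattice path in $\mathbb Z^2$ that starts at the origin and has the word $(ab^2)^n$, where $a$ is a unit step to the right and $b$ a unit step up. Let $L_\gamma$ be the set of lattice points on or below $L$ and weakly above the horizontal axis, with the partial order in which $(x_2,y_2)$ covers $(x_1,y_1)$ iff $(x_2,y_2)$ is $(x_1+1,y_1)$ or $(x_1,y_1+1)$. **Proposition.** All sequences of flips from $\Delta$ that reach a triangulation containing the arc $ij$ give one and the same variable $x_\gamma$ on $i\to j$ (and such sequences exist). It has a unique Laurent expansion with integer coefficients in the initial variables, and: (a) the Laurent expansion of $x_\gamma$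 has exactly $(n+1)^2$ terms, each with coefficient $1$; (b) $\mathbb T_\gamma$ is a poset whose covering relations are exactly the above multiplications, and its minimal element is (the weight of) the $3$-edge $T$-path that goes along the boundary $i\to p_1$, back along the diagonal $fp_1$ closest to $i$, and along the boundary $f\to j$, i.e. the monomial $\dfrac{x_{i\to p_1}\,x_{f\to j}}{x_{f\to p_1}}$; it lies below every other element; (c) its maximal element is the $3$-edge $T$-path that goes along $i\to f$, back along the diagonal $fp_n$ furthest from $i$, and along the boundary $p_n\to j$, i.e. the monomial $\dfrac{x_{i\to f}\,x_{p_n\to j}}{x_{p_n\to f}}$; it lies above every other element; (d) $\mathbb T_\gamma$ is isomorphic, as a poset, to $L_\gamma$ (equivalently, their Hasse diagrams are isomorphic as directed graphs). -/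

import Mathlib

namespace SL3Fan

/-! ### Directed edges and faces of a polygon -/

/-- The elements of which colored `SL₃` diagrams on the `(n+3)`-gon are made: directed edges `a → b`
(`Sum.inl (a, b)`) and triangular faces (`Sum.inr` of the set of vertices).
The vertices `0, 1, …, n + 2` are numbered in cyclic order along the boundary. -/
abbrev Element (n : ℕ) := (Fin (n + 3) × Fin (n + 3)) ⊕ Finset (Fin (n + 3))

/-- The directed edge `a → b`: of the two variables on the arc `ab`, the one closest to `a`. -/
abbrev edge {n : ℕ} (a b : Fin (n + 3)) : Element n := Sum.inl (a, b)

/-- The face with vertices `a`, `b`, `c`. -/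
abbrev face {n : ℕ} (a b c : Fin (n + 3)) : Element n := Sum.inr {a, b, c}

/-- Boundary edges carry frozen variables; all the other variables are mutable. -/
def IsFrozen {n : ℕ} : Element n → Prop
  | Sum.inl (a, b) => b = a + 1 ∨ a = b + 1
  | Sum.inr _ => False

/-! ### The fan triangulation and its 3-triangulation quiver -/

/-- The fan vertex. -/
abbrev fanVertex (n : ℕ) : Fin (n + 3) := 0

/-- The other vertices `p₀, …, p_{n+1}` of the polygon, in cyclic order. The internal diagonals of the
fan triangulation join the fan vertex with `p₁, …, pₙ`. -/
abbrev p {n : ℕ} (k : Fin (n + 2)) : Fin (n + 3) := k.succ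

/-- The vertices of the `k`-th triangle of the fan: the fan vertex, `p_k` and `p_{k+1}`. -/
def fanTriangle {n : ℕ} (k : Fin (n + 1)) : Finset (Fin (n + 3)) :=
  {fanVertex n, p k.castSucc, p k.succ}

/-- The directed edges and the faces of the fan triangulation (boundary edges included). -/
def initialElements (n : ℕ) : Finset (Element n) :=
  Finset.univ.biUnion fun k : Fin (n + 1) =>
    (fanTriangle k).offDiag.image Sum.inl ∪ {Sum.inr (fanTriangle k)}

/-- The nodes of the initial quiver. -/
abbrev Node (n : ℕ) := {e : Element n // e ∈ initialElements n}

/-- The 3-cycle at the corner `a` of a triangle with vertices `a`, `b`, `c` in this cyclic order. If the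
cyclic order is counterclockwise, then the 3-cycle is clockwise. -/
def cornerArrows {n : ℕ} (a b c : Fin (n + 3)) : List (Element n × Element n) :=
  [(face a b c, edge a b), (edge a b, edge a c), (edge a c, face a b c)]

/-- The arrows inside the `k`-th triangle of the fan: three 3-cycles which share the face node. -/
def triangleArrows {n : ℕ} (k : Fin (n + 1)) : List (Element n × Element n) :=
  cornerArrows (fanVertex n) (p k.castSucc) (p k.succ) ++
    cornerArrows (p k.castSucc) (p k.succ) (fanVertex n) ++
    cornerArrows (p k.succ) (fanVertex n) (p k.castSucc)

/-- The signed number of arrows `u → v` in the quiver of the 3-triangulation whose 3-cycles are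
clockwise. `ε = 1` if the vertices `0, 1, …, n + 2` are in counterclockwise order, and `ε = -1` if they
are in clockwise order. -/
def initialB {n : ℕ} (ε : ℤˣ) (u v : Node n) : ℤ :=
  ε * ∑ k : Fin (n + 1),
    (((triangleArrows k).count (u.1, v.1) : ℤ) - ((triangleArrows k).count (v.1, u.1) : ℤ))

/-! ### Seeds, mutations and flips -/

/-- The ambient field of rational functions in the initial variables. -/
abbrev Ambient (n : ℕ) := FractionRing (MvPolynomial (Node n) ℚ)

/-- The initial variable on a node of the initial quiver. -/
noncomputable def initialX {n : ℕ} (u : Node n) : Ambient n :=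
  algebraMap (MvPolynomial (Node n) ℚ) (Ambient n) (MvPolynomial.X u)

/-- A seed of the cluster algebra attached to a triangulation of the polygon: `label` says which directed
edge or face of the triangulation each node is placed on, `B u v` is the signed number of arrows
`u → v`, and `x` is the extended cluster. -/
structure Seed (n : ℕ) where
  label : Node n → Element n
  B : Node n → Node n → ℤ
  x : Node n → Ambient n

/-- The seed of the fan triangulation. -/
noncomputable def initialSeed (n : ℕ) (ε : ℤˣ) : Seed n where
  label := Subtype.val
  B := initialB ε
  x := initialX

/-- Seed mutation at the node `k` (the labels are left alone). -/
noncomputable def Seed.mutate {n : ℕ} (s : Seed n) (k : Node n) : Seed n where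
  label := s.label
  B := fun u v =>
    if u = k ∨ v = k then -s.B u v
    else s.B u v + (max (s.B u k) 0 * max (s.B k v) 0 - max (-s.B u k) 0 * max (-s.B k v) 0)
  x := Function.update s.x k
    ((∏ u, s.x u ^ (s.B u k).toNat + ∏ u, s.x u ^ (s.B k u).toNat) / s.x k)

/-- `s'` arises from `s` by the flip of a diagonal `ac` into `bd`, where `abc` and `acd` are the two
triangles at `ac`: mutate at the two nodes on `ac`, then at the nodes of the two faces.
Afterwards the four nodes are on the faces `abd`, `bcd` and on the edges `b → d`, `d → b`. -/
def Flip {n : ℕ} (s s' : Seed n) : Prop :=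
  ∃ (a b c d : Fin (n + 3)) (u₁ u₂ u₃ u₄ : Node n),
    a ≠ b ∧ a ≠ c ∧ a ≠ d ∧ b ≠ c ∧ b ≠ d ∧ c ≠ d ∧
    s.label u₁ = edge a c ∧ s.label u₂ = edge c a ∧
    s.label u₃ = face a b c ∧ s.label u₄ = face a c d ∧
    s' =
      { (((s.mutate u₁).mutate u₂).mutate u₃).mutate u₄ with
        label := Function.update (Function.update (Function.update (Function.update s.label
          u₁ (face a b d)) u₂ (face b c d)) u₃ (edge b d)) u₄ (edge d b) }

/-- `z` is the variable attached to `e` in some seed that is reached from the initial seed by flips. -/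
def IsVariableOf {n : ℕ} (ε : ℤˣ) (e : Element n) (z : Ambient n) : Prop :=
  ∃ s : Seed n, Relation.ReflTransGen Flip (initialSeed n ε) s ∧ ∃ u, s.label u = e ∧ s.x u = z

/-- The longest directed edge `γ = i → j`, with `i = p₀` and `j = p_{n+1}`. -/
abbrev longestEdge (n : ℕ) : Element n := edge (p 0) (p (Fin.last (n + 1)))

/-! ### Laurent expansions and the expansion poset -/

/-- The Laurent monomial (the weight of a colored diagram) with the given exponents. -/
noncomputable def monomial {n : ℕ} (m : Node n → ℤ) : Ambient n := ∏ u, initialX u ^ m u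

/-- `c` is the family of coefficients of an expansion of `z` as a Laurent polynomial with integer
coefficients in the initial variables. -/
def IsLaurentExpansion {n : ℕ} (z : Ambient n) (c : (Node n → ℤ) →₀ ℤ) : Prop :=
  z = c.sum fun m a => (a : Ambient n) * monomial m

/-- The exponents of `ŷ_u = ∏_{v → u} x_v / ∏_{u → v} x_v`. -/
def yHat {n : ℕ} (ε : ℤˣ) (u v : Node n) : ℤ := initialB ε v u

/-- The terms of a Laurent polynomial. -/
def Term {n : ℕ} (c : (Node n → ℤ) →₀ ℤ) := {m : Node n → ℤ // m ∈ c.support}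

/-- `m'` arises from `m` by multiplication by `ŷ_u ^ ε` for a mutable node `u`. -/
def YStep {n : ℕ} (ε : ℤˣ) {c : (Node n → ℤ) →₀ ℤ} (m m' : Term c) : Prop :=
  ∃ u : Node n, ¬ IsFrozen u.1 ∧ ∀ v, m'.1 v = m.1 v + ε * yHat ε u v

/-- The exponents of the weight `x_{a → b} x_{c → b}⁻¹ x_{c → d}` of the path `a, b, c, d` which
consists of a blue edge `a → b`, a red edge `c → b` (traversed backwards) and a blue edge `c → d`. -/
def threeEdgePath {n : ℕ} (a b c d : Fin (n + 3)) (u : Node n) : ℤ :=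
  (if u.1 = edge a b then 1 else 0) - (if u.1 = edge c b then 1 else 0) +
    (if u.1 = edge c d then 1 else 0)

/-! ### The region `L_γ` -/

/-- The letters of binary words. -/
inductive Letter
  | a
  | b

/-- The letter `a` is a unit step to the right, the letter `b` is a unit step up. -/
def Letter.step : Letter → ℤ × ℤ
  | .a => (1, 0)
  | .b => (0, 1)

/-- The lattice points on the lattice path which starts at the origin and has the word `w`. -/
def latticePath (w : List Letter) : List (ℤ × ℤ) :=
  w.scanl (fun q l => q + l.step) (0, 0)

/-- The word `(ab²)ⁿ`. -/
def abbWord (n : ℕ) : List Letter := (List.replicate n [Letter.a, Letter.b, Letter.b]).flatten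

/-- The lattice points on or below the path `(ab²)ⁿ` and weakly above the horizontal axis. -/
def LRegion (n : ℕ) : Set (ℤ × ℤ) :=
  {q | 0 ≤ q.2 ∧ ∃ r ∈ latticePath (abbWord n), r.1 = q.1 ∧ q.2 ≤ r.2}

/-- `r` covers `q` in `L_γ`. -/
def LCovers {n : ℕ} (q r : LRegion n) : Prop :=
  (r.1.1 = q.1.1 + 1 ∧ r.1.2 = q.1.2) ∨ (r.1.1 = q.1.1 ∧ r.1.2 = q.1.2 + 1)

end SL3Fan

open SL3Fan

/-! The variables are realised geometrically. Attach to each vertex `a` a vector `v_a` and a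
covector `ψ_a` in three-space with `ψ_a(v_a) = 0`. Put `ψ_a(v_b)` on the edge `a → b`, and the
determinant of `v_a, v_b, v_c`, with the sign of the orientation, on the face `abc`. Applying a
covector to the linear relation between four vectors in three-space gives the Plücker relations.
When the covector belongs to one of the four vectors, three terms remain, and these are the exchange
relations of the four mutations of a flip. Locally a flip is a finite computation with a quiver on
twelve nodes. Hence "the quiver is the sum over the triangles, and the variables come from the
configuration" is preserved by flips (`IsSeedOf.flip`). The value on `i → j` therefore does not
depend on the sequence of flips.

It remains to find a configuration with the initial variables as its values on the fan. In an affine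
chart adapted to `f`, the face variables prescribe the widths between consecutive `p_k`, and the
boundary variables prescribe the changes of slope. Evaluating the covector of `i` on the vector of
`j` integrates the slope (`FanCoordinates.pairing_one`). The outcome is a double sum of monomials
indexed by `0 ≤ k ≤ n` and `0 ≤ m ≤ 2k`, hence `1 + 3 + ⋯ + (2n+1) = (n+1)²` terms.

The index set is exactly the region under `(ab²)ⁿ`. Raising `k` by one multiplies the term by the
`ŷ` of an edge `f → p_l`; raising `m` by one multiplies it by the `ŷ` of a face or of an edge `p_l →
f`, in alternation. Conversely, two linear weights on exponents recover `(k, m)` and change under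
each mutable `ŷ` exactly like one of the two unit steps. So the terms are distinct, and no other
multiplication by a `ŷ` connects two of them (`weight_termExp`, `weight_yExp`, `yStep_termAt`). -/

namespace SL3Fan

/-! ### Crossing chords and orientations in a cyclic order -/

section Order

variable {α : Type*} [LinearOrder α]

/-- The chords `ac` and `bd` of a convex polygon with cyclically ordered vertices cross. -/
def Crosses (a c b d : α) : Prop :=
  (((a < b ∧ b < c) ∨ (c < b ∧ b < a)) ∧ ((d < a ∧ d < c) ∨ (a < d ∧ c < d))) ∨
    (((a < d ∧ d < c) ∨ (c < d ∧ d < a)) ∧ ((b < a ∧ b < c) ∨ (a < b ∧ c < b)))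

/-- The orientation of a triangle: `1` if its vertices are in cyclic order, otherwise `-1`. -/
def orient (a b c : α) : ℤˣ :=
  if (a < b ∧ b < c) ∨ (b < c ∧ c < a) ∨ (c < a ∧ a < b) then 1 else -1

theorem orient_rotate (a b c : α) : orient b c a = orient a b c := by
  unfold orient
  grind

theorem orient_swap {a b c : α} (hab : a ≠ b) (hac : a ≠ c) (hbc : b ≠ c) :
    orient a c b = -orient a b c := by
  unfold orient
  split_ifs <;> first | rfl | (exfalso; grind)

/-- Of the three ways to pair four points on a circle into two chords, exactly one crosses. -/
theorem crosses_of_not_crosses {a b c d : α} (hab : a ≠ b) (hac : a ≠ c) (had : a ≠ d)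
    (hbc : b ≠ c) (hbd : b ≠ d) (hcd : c ≠ d) (h₁ : ¬ Crosses a b c d) (h₂ : ¬ Crosses b c a d) :
    Crosses a c b d := by
  unfold Crosses at *
  grind (splits := 25)

/-- All triangles inside a convex quadrilateral, read in its cyclic order, have the same
orientation. This common sign factors out of the exchange relations and of the local quiver. -/
theorem Crosses.orient_eq {a b c d : α} (h : Crosses a c b d) :
    orient a c d = orient a b c ∧ orient a b d = orient a b c ∧ orient b c d = orient a b c := by
  unfold Crosses orient at *
  grind (splits := 25)

theorem Crosses.rotate {a b c d : α} (h : Crosses a c b d) : Crosses b d c a := by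
  unfold Crosses at *
  grind (splits := 25)

theorem Crosses.symm {a b c d : α} (h : Crosses a c b d) : Crosses b d a c := by
  unfold Crosses at *
  grind (splits := 25)

theorem Crosses.left_comm {a b c d : α} (h : Crosses a c b d) : Crosses c a b d := by
  unfold Crosses at *
  grind (splits := 25)

theorem Crosses.ne {a b c d : α} (h : Crosses a c b d) :
    a ≠ b ∧ a ≠ c ∧ a ≠ d ∧ b ≠ c ∧ b ≠ d ∧ c ≠ d := by
  unfold Crosses at *
  grind (splits := 25)

/-- No third triangle fits at the diagonal `ac` of a quadrilateral `abcd`. -/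
theorem Crosses.third_triangle {a b c d e : α} (h : Crosses a c b d) (hea : e ≠ a) (heb : e ≠ b)
    (hec : e ≠ c) (hed : e ≠ d) :
    Crosses a e b c ∨ Crosses e c a b ∨ Crosses a e c d ∨ Crosses e c a d := by
  unfold Crosses at *
  grind (splits := 25)

/-- A chord which crosses the diagonal `bd` of a quadrilateral `abcd` crosses one of its sides, or
it is the other diagonal. -/
theorem Crosses.crosses_side {a b c d x y : α} (h : Crosses a c b d) (hxy : Crosses x y b d) :
    Crosses x y a b ∨ Crosses x y b c ∨ Crosses x y c d ∨ Crosses x y a d ∨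
      (x = a ∧ y = c) ∨ (x = c ∧ y = a) := by
  unfold Crosses at *
  grind (splits := 25)

end Order

/-! ### Mutation inside a quadrilateral -/

/-- Lets `List.count` be used on lists of pairs of `Element`s, which form a sum type. -/
instance {α β : Type*} [BEq α] [BEq β] [LawfulBEq α] [LawfulBEq β] : LawfulBEq (α ⊕ β) where
  rfl {x} := by rcases x with x | x <;> exact beq_self_eq_true x
  eq_of_beq {x y} h := by
    rcases x with x | x <;> rcases y with y | y
    · exact congrArg _ (eq_of_beq (α := α) h)
    · cases h
    · cases h
    · exact congrArg _ (eq_of_beq (α := β) h)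

/-- The exchange matrix of the quiver with the given list of arrows. -/
def arrowMatrix {ι : Type*} [BEq ι] (L : List (ι × ι)) (i j : ι) : ℤ :=
  (L.count (i, j) : ℤ) - (L.count (j, i) : ℤ)

/-- Mutation of exchange matrices. -/
def mutateMatrix {ι : Type*} [DecidableEq ι] (Q : ι → ι → ℤ) (k i j : ι) : ℤ :=
  if i = k ∨ j = k then -Q i j
  else Q i j + (max (Q i k) 0 * max (Q k j) 0 - max (-Q i k) 0 * max (-Q k j) 0)

/-- The arrows of the two triangles `abc` and `acd` of a quadrilateral. The nodes `0`, …, `11` are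
`a → c`, `c → a`, `abc`, `acd`, `a → b`, `b → a`, `b → c`, `c → b`, `c → d`, `d → c`, `d → a`,
`a → d`. -/
def quadArrows : List (Fin 12 × Fin 12) :=
  [(2, 4), (4, 0), (0, 2), (2, 6), (6, 5), (5, 2), (2, 1), (1, 7), (7, 2),
    (3, 0), (0, 11), (11, 3), (3, 8), (8, 1), (1, 3), (3, 10), (10, 9), (9, 3)]

/-- The result of the mutation of `quadArrows` at `0`. -/
def quadArrows₁ : List (Fin 12 × Fin 12) :=
  [(0, 3), (0, 4), (1, 3), (1, 7), (2, 0), (2, 1), (2, 6), (3, 2), (3, 8), (3, 10), (4, 11),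
    (5, 2), (6, 5), (7, 2), (8, 1), (9, 3), (10, 9), (11, 0)]

/-- The result of the mutation of `quadArrows` at `0` and `1`. -/
def quadArrows₂ : List (Fin 12 × Fin 12) :=
  [(0, 3), (0, 4), (1, 2), (1, 8), (2, 0), (2, 6), (3, 1), (3, 10), (4, 11), (5, 2), (6, 5),
    (7, 1), (8, 7), (9, 3), (10, 9), (11, 0)]

/-- The result of the mutation of `quadArrows` at `0`, `1` and `2`. -/
def quadArrows₃ : List (Fin 12 × Fin 12) :=
  [(0, 2), (0, 3), (0, 4), (1, 0), (1, 6), (1, 8), (2, 1), (2, 5), (3, 1), (3, 10), (4, 11),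
    (5, 0), (6, 2), (7, 1), (8, 7), (9, 3), (10, 9), (11, 0)]

/-- The nodes of the quadrilateral `abcd` after the flip, as nodes of the quadrilateral `bcda`. -/
def quadRotation : Fin 12 → Fin 12 := ![3, 2, 0, 1, 10, 11, 4, 5, 6, 7, 8, 9]

theorem mutateMatrix_quadArrows :
    ∀ i j, mutateMatrix (arrowMatrix quadArrows) 0 i j = arrowMatrix quadArrows₁ i j := by
  decide +kernel

theorem mutateMatrix_quadArrows₁ :
    ∀ i j, mutateMatrix (arrowMatrix quadArrows₁) 1 i j = arrowMatrix quadArrows₂ i j := by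
  decide +kernel

theorem mutateMatrix_quadArrows₂ :
    ∀ i j, mutateMatrix (arrowMatrix quadArrows₂) 2 i j = arrowMatrix quadArrows₃ i j := by
  decide +kernel

/-- The last of the four mutations closes the circle: up to `quadRotation` the quiver is again that
of a quadrilateral, now cut along the other diagonal. -/
theorem mutateMatrix_quadArrows₃ :
    ∀ i j, mutateMatrix (arrowMatrix quadArrows₃) 3 i j =
      arrowMatrix quadArrows (quadRotation i) (quadRotation j) := by
  decide +kernel

/-- The new cluster variable of a mutation at `k`. -/
noncomputable def exchange {ι K : Type*} [Fintype ι] [Field K] (Q : ι → ι → ℤ) (y : ι → K) (k : ι) :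
    K :=
  (∏ i, y i ^ (Q i k).toNat + ∏ i, y i ^ (Q k i).toNat) / y k

/-- Reversing all arrows only swaps the two monomials of the exchange relation, so the variables do
not see the orientation. -/
theorem exchange_units_mul {ι K : Type*} [Fintype ι] [Field K] (δ : ℤˣ) {Q : ι → ι → ℤ}
    (hQ : ∀ i j, Q i j = -Q j i) (y : ι → K) (k : ι) :
    exchange (fun i j => δ * Q i j) y k = exchange Q y k := by
  rcases Int.units_eq_one_or δ with rfl | rfl
  · simp [exchange]
  · unfold exchange
    rw [add_comm]
    simp only [Units.val_neg, Units.val_one, neg_mul, one_mul]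
    congr 3 <;> ext i
    · rw [hQ k i, neg_neg]
    · rw [hQ i k, neg_neg]

theorem mutateMatrix_units_mul {ι : Type*} [DecidableEq ι] (δ : ℤˣ) (Q : ι → ι → ℤ) (k i j : ι) :
    mutateMatrix (fun i j => δ * Q i j) k i j = δ * mutateMatrix Q k i j := by
  rcases Int.units_eq_one_or δ with rfl | rfl
  · simp
  · unfold mutateMatrix
    simp only [Units.val_neg, Units.val_one, neg_mul, one_mul, neg_neg]
    split_ifs
    · exact (neg_neg _).symm
    · ring

theorem arrowMatrix_swap {ι : Type*} [BEq ι] (L : List (ι × ι)) (i j : ι) :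
    arrowMatrix L i j = -arrowMatrix L j i := by
  unfold arrowMatrix
  ring

variable {n : ℕ}

/-- On the nodes in the image of `τ`, the seed `s` differs from the matrix `O` by the quiver `Q`, and
its variables are `y`. Everything else is as in `O` and `x`. -/
structure IsLocally {ι : Type*} (O : Node n → Node n → ℤ) (x : Node n → Ambient n) (τ : ι → Node n)
    (Q : ι → ι → ℤ) (y : ι → Ambient n) (s : Seed n) : Prop where
  on : ∀ i j, s.B (τ i) (τ j) = O (τ i) (τ j) + Q i j
  off : ∀ u v, (u ∉ Set.range τ ∨ v ∉ Set.range τ) → s.B u v = O u v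
  var : ∀ i, s.x (τ i) = y i
  var_off : ∀ u, u ∉ Set.range τ → s.x u = x u

/-- By `hO` the background `O` has no arrows at the mutated node. So the exchange monomials involve
only nodes in the image of `τ`, and every correction to an entry outside it has a zero factor. -/
theorem IsLocally.mutate {ι : Type*} [Fintype ι] [DecidableEq ι] {O : Node n → Node n → ℤ}
    {x : Node n → Ambient n} {τ : ι → Node n} (hτ : Function.Injective τ)
    {Q : ι → ι → ℤ} {y : ι → Ambient n} {s : Seed n} (h : IsLocally O x τ Q y s) {k : ι}
    (hO : ∀ u, O u (τ k) = 0 ∧ O (τ k) u = 0) :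
    IsLocally O x τ (mutateMatrix Q k) (Function.update y k (exchange Q y k))
      (s.mutate (τ k)) where
  on i j := by
    have h1 := h.on i k
    have h2 := h.on k j
    rw [(hO _).1, zero_add] at h1
    rw [(hO _).2, zero_add] at h2
    simp only [Seed.mutate, mutateMatrix, hτ.eq_iff, h.on i j, h1, h2]
    split_ifs with hk
    · have : O (τ i) (τ j) = 0 := by
        rcases hk with rfl | rfl
        · exact (hO _).2
        · exact (hO _).1
      rw [this, zero_add, zero_add]
    · ring
  off u v huv := by
    have hu : u ∉ Set.range τ → s.B u (τ k) = 0 := fun hu => by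
      rw [h.off _ _ (Or.inl hu), (hO u).1]
    have hv : v ∉ Set.range τ → s.B (τ k) v = 0 := fun hv => by
      rw [h.off _ _ (Or.inr hv), (hO v).2]
    simp only [Seed.mutate, h.off u v huv]
    split_ifs with hk
    · rcases hk with rfl | rfl
      · simp [(hO v).2]
      · simp [(hO u).1]
    · rcases huv with h' | h'
      · simp [hu h']
      · simp [hv h']
  var i := by
    rcases eq_or_ne i k with rfl | hik
    · simp only [Seed.mutate, Function.update_self, exchange, h.var]
      congr 2
      · symm
        refine Fintype.prod_of_injective τ hτ _ _ (fun u hu => ?_) (fun j => ?_)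
        · rw [h.off _ _ (Or.inl hu), (hO u).1]; simp
        · rw [h.on, (hO _).1, h.var, zero_add]
      · symm
        refine Fintype.prod_of_injective τ hτ _ _ (fun u hu => ?_) (fun j => ?_)
        · rw [h.off _ _ (Or.inr hu), (hO u).2]; simp
        · rw [h.on, (hO _).2, h.var, zero_add]
    · simp only [Seed.mutate]
      rw [Function.update_of_ne hik, Function.update_of_ne (hτ.ne hik), h.var]
  var_off u hu := by
    simp only [Seed.mutate]
    rw [Function.update_of_ne (fun h' => hu ⟨k, h'.symm⟩), h.var_off u hu]

section Exchange

variable {K : Type*} [Field K] (y : Fin 12 → K)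

/-- At each of the four mutations of a flip the mutated node has two incoming and two outgoing
arrows, so the exchange relation has the shape of a three-term Plücker relation. -/
theorem exchange_quadArrows :
    exchange (arrowMatrix quadArrows) y 0 = (y 3 * y 4 + y 2 * y 11) / y 0 := by
  have h₁ : ∀ i, (arrowMatrix quadArrows i 0).toNat = ![0, 0, 0, 1, 1, 0, 0, 0, 0, 0, 0, 0] i := by
    decide +kernel
  have h₂ : ∀ i, (arrowMatrix quadArrows 0 i).toNat = ![0, 0, 1, 0, 0, 0, 0, 0, 0, 0, 0, 1] i := by
    decide +kernel
  simp only [exchange, h₁, h₂]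
  simp [Fin.prod_univ_succ]

theorem exchange_quadArrows₁ :
    exchange (arrowMatrix quadArrows₁) y 1 = (y 2 * y 8 + y 3 * y 7) / y 1 := by
  have h₁ : ∀ i, (arrowMatrix quadArrows₁ i 1).toNat = ![0, 0, 1, 0, 0, 0, 0, 0, 1, 0, 0, 0] i := by
    decide +kernel
  have h₂ : ∀ i, (arrowMatrix quadArrows₁ 1 i).toNat = ![0, 0, 0, 1, 0, 0, 0, 1, 0, 0, 0, 0] i := by
    decide +kernel
  simp only [exchange, h₁, h₂]
  simp [Fin.prod_univ_succ]

theorem exchange_quadArrows₂ :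
    exchange (arrowMatrix quadArrows₂) y 2 = (y 1 * y 5 + y 0 * y 6) / y 2 := by
  have h₁ : ∀ i, (arrowMatrix quadArrows₂ i 2).toNat = ![0, 1, 0, 0, 0, 1, 0, 0, 0, 0, 0, 0] i := by
    decide +kernel
  have h₂ : ∀ i, (arrowMatrix quadArrows₂ 2 i).toNat = ![1, 0, 0, 0, 0, 0, 1, 0, 0, 0, 0, 0] i := by
    decide +kernel
  simp only [exchange, h₁, h₂]
  simp [Fin.prod_univ_succ]

theorem exchange_quadArrows₃ :
    exchange (arrowMatrix quadArrows₃) y 3 = (y 0 * y 9 + y 1 * y 10) / y 3 := by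
  have h₁ : ∀ i, (arrowMatrix quadArrows₃ i 3).toNat = ![1, 0, 0, 0, 0, 0, 0, 0, 0, 1, 0, 0] i := by
    decide +kernel
  have h₂ : ∀ i, (arrowMatrix quadArrows₃ 3 i).toNat = ![0, 1, 0, 0, 0, 0, 0, 0, 0, 0, 1, 0] i := by
    decide +kernel
  simp only [exchange, h₁, h₂]
  simp [Fin.prod_univ_succ]

end Exchange

/-- The four mutations of a flip. -/
theorem IsLocally.flip {O : Node n → Node n → ℤ} {x : Node n → Ambient n} {τ : Fin 12 → Node n}
    (hτ : Function.Injective τ) (δ : ℤˣ) {y z : Fin 12 → Ambient n} {s : Seed n}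
    (h : IsLocally O x τ (fun i j => δ * arrowMatrix quadArrows i j) y s)
    (hO : ∀ k : Fin 12, k < 4 → ∀ u, O u (τ k) = 0 ∧ O (τ k) u = 0)
    (hz : ∀ i, 4 ≤ i → z i = y i)
    (h₀ : z 0 = (y 3 * y 4 + y 2 * y 11) / y 0) (h₁ : z 1 = (y 2 * y 8 + y 3 * y 7) / y 1)
    (h₂ : z 2 = (z 1 * y 5 + z 0 * y 6) / y 2) (h₃ : z 3 = (z 0 * y 9 + z 1 * y 10) / y 3) :
    IsLocally O x τ (fun i j => δ * arrowMatrix quadArrows (quadRotation i) (quadRotation j)) z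
      ((((s.mutate (τ 0)).mutate (τ 1)).mutate (τ 2)).mutate (τ 3)) := by
  have e₀ := h.mutate hτ (hO 0 (by decide))
  simp only [exchange_units_mul δ (arrowMatrix_swap _)] at e₀
  rw [exchange_quadArrows, ← h₀, show mutateMatrix (fun i j => δ * arrowMatrix quadArrows i j) 0 =
    fun i j => δ * arrowMatrix quadArrows₁ i j by
      ext i j; rw [mutateMatrix_units_mul, mutateMatrix_quadArrows]] at e₀
  have e₁ := e₀.mutate hτ (hO 1 (by decide))
  rw [exchange_units_mul δ (arrowMatrix_swap _), exchange_quadArrows₁,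
    show mutateMatrix (fun i j => δ * arrowMatrix quadArrows₁ i j) 1 =
    fun i j => δ * arrowMatrix quadArrows₂ i j by
      ext i j; rw [mutateMatrix_units_mul, mutateMatrix_quadArrows₁]] at e₁
  have e₂ := e₁.mutate hτ (hO 2 (by decide))
  rw [exchange_units_mul δ (arrowMatrix_swap _), exchange_quadArrows₂,
    show mutateMatrix (fun i j => δ * arrowMatrix quadArrows₂ i j) 2 =
    fun i j => δ * arrowMatrix quadArrows₃ i j by
      ext i j; rw [mutateMatrix_units_mul, mutateMatrix_quadArrows₂]] at e₂
  have e₃ := e₂.mutate hτ (hO 3 (by decide))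
  rw [exchange_units_mul δ (arrowMatrix_swap _), exchange_quadArrows₃,
    show mutateMatrix (fun i j => δ * arrowMatrix quadArrows₃ i j) 3 =
    fun i j => δ * arrowMatrix quadArrows (quadRotation i) (quadRotation j) by
      ext i j; rw [mutateMatrix_units_mul, mutateMatrix_quadArrows₃]] at e₃
  convert e₃ using 1
  funext i
  have hne : ∀ (f : Fin 12 → Ambient n) (i k : Fin 12) (c : Ambient n), i ≠ k →
      Function.update f k c i = f i := fun f i k c hik => Function.update_of_ne hik _ _
  by_cases hi : 4 ≤ i
  · rw [hz i hi, hne _ _ _ _ (by rintro rfl; revert hi; decide),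
      hne _ _ _ _ (by rintro rfl; revert hi; decide),
      hne _ _ _ _ (by rintro rfl; revert hi; decide),
      hne _ _ _ _ (by rintro rfl; revert hi; decide)]
  · have : i = 0 ∨ i = 1 ∨ i = 2 ∨ i = 3 := by revert i; decide
    simp only [Function.update_self, hne _ 0 1 _ (by decide), hne _ 0 2 _ (by decide),
      hne _ 1 0 _ (by decide), hne _ 1 2 _ (by decide),
      hne _ 2 0 _ (by decide), hne _ 2 1 _ (by decide), hne _ 3 0 _ (by decide),
      hne _ 3 1 _ (by decide),
      hne _ 3 2 _ (by decide), hne _ 5 0 _ (by decide), hne _ 5 1 _ (by decide),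
      hne _ 6 0 _ (by decide), hne _ 6 1 _ (by decide), hne _ 7 0 _ (by decide),
      hne _ 8 0 _ (by decide), hne _ 9 0 _ (by decide), hne _ 9 1 _ (by decide),
      hne _ 9 2 _ (by decide), hne _ 10 0 _ (by decide), hne _ 10 1 _ (by decide),
      hne _ 10 2 _ (by decide)]
    rcases this with rfl | rfl | rfl | rfl
    · simp only [Function.update_self, hne _ 0 1 _ (by decide), hne _ 0 2 _ (by decide),
        hne _ 0 3 _ (by decide)]
    · simp only [Function.update_self, hne _ 1 2 _ (by decide), hne _ 1 3 _ (by decide), h₁]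
    · simp only [Function.update_self, hne _ 2 3 _ (by decide), h₂, h₁]
    · simp only [Function.update_self, h₃, h₁]

/-! ### Functions of triangles -/

section Triangles

variable {α : Type*} [DecidableEq α]

theorem triple_eq_triple {a b c a' b' c' : α} (hab : a ≠ b) (hac : a ≠ c)
    (hbc : b ≠ c) (h : ({a, b, c} : Finset α) = {a', b', c'}) :
    (a' = a ∧ b' = b ∧ c' = c) ∨ (a' = a ∧ b' = c ∧ c' = b) ∨ (a' = b ∧ b' = c ∧ c' = a) ∨
      (a' = b ∧ b' = a ∧ c' = c) ∨ (a' = c ∧ b' = a ∧ c' = b) ∨ (a' = c ∧ b' = b ∧ c' = a) := by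
  have h1 : a ∈ ({a', b', c'} : Finset α) := h ▸ by simp
  have h2 : b ∈ ({a', b', c'} : Finset α) := h ▸ by simp
  have h3 : c ∈ ({a', b', c'} : Finset α) := h ▸ by simp
  simp only [Finset.mem_insert, Finset.mem_singleton] at h1 h2 h3
  grind

theorem triple_rotate (a b c : α) : ({b, c, a} : Finset α) = {a, b, c} := by
  ext; simp; tauto

theorem triple_swap (a b c : α) : ({a, c, b} : Finset α) = {a, b, c} := by
  ext; simp; tauto

open Classical in
/-- The function of triangles given by a function of the vertices. -/
noncomputable def triLift {A : Type*} [Zero A] (F : α → α → α → A) (t : Finset α) : A :=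
  if h : ∃ q : α × α × α, q.1 ≠ q.2.1 ∧ q.1 ≠ q.2.2 ∧ q.2.1 ≠ q.2.2 ∧ t = {q.1, q.2.1, q.2.2} then
    F h.choose.1 h.choose.2.1 h.choose.2.2
  else 0

theorem triLift_eq {A : Type*} [Zero A] {F : α → α → α → A}
    (hrot : ∀ a b c, a ≠ b → a ≠ c → b ≠ c → F b c a = F a b c)
    (hswap : ∀ a b c, a ≠ b → a ≠ c → b ≠ c → F a c b = F a b c)
    {a b c : α} (hab : a ≠ b) (hac : a ≠ c) (hbc : b ≠ c) :
    triLift F {a, b, c} = F a b c := by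
  have h : ∃ q : α × α × α, q.1 ≠ q.2.1 ∧ q.1 ≠ q.2.2 ∧ q.2.1 ≠ q.2.2 ∧
      ({a, b, c} : Finset α) = {q.1, q.2.1, q.2.2} := ⟨(a, b, c), hab, hac, hbc, rfl⟩
  rw [triLift, dif_pos h]
  generalize hq : h.choose = q
  have hs := h.choose_spec
  rw [hq] at hs
  obtain ⟨x, y, z⟩ := q
  obtain ⟨-, -, -, hs⟩ := hs
  rcases triple_eq_triple hab hac hbc hs with ⟨h1, h2, h3⟩ | ⟨h1, h2, h3⟩ | ⟨h1, h2, h3⟩ |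
    ⟨h1, h2, h3⟩ | ⟨h1, h2, h3⟩ | ⟨h1, h2, h3⟩ <;> dsimp only at h1 h2 h3 ⊢ <;>
    subst h1 h2 h3
  · rfl
  · exact hswap _ _ _ hab hac hbc
  · exact hrot _ _ _ hab hac hbc
  · rw [← hrot _ _ _ hab.symm hbc hac, hswap _ _ _ hab hac hbc]
  · rw [hrot _ _ _ hac.symm hbc.symm hab]
  · rw [hswap _ _ _ hac.symm hbc.symm hab, hrot _ _ _ hac.symm hbc.symm hab]

end Triangles

/-! ### Exchange matrices of triangles -/

/-- The arrows inside the triangle `abc`, if the vertices are in cyclic order. -/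
def triArrows (a b c : Fin (n + 3)) : List (Element n × Element n) :=
  cornerArrows a b c ++ cornerArrows b c a ++ cornerArrows c a b

/-- The exchange matrix of the triangle `abc`. -/
def triMatrix (a b c : Fin (n + 3)) (e e' : Element n) : ℤ :=
  orient a b c * arrowMatrix (triArrows a b c) e e'

/-- The exchange matrix of a triangle. -/
noncomputable def triangleMatrix (t : Finset (Fin (n + 3))) (e e' : Element n) : ℤ :=
  triLift (fun a b c => triMatrix a b c e e') t

/-- The directed edges and the face of a triangle. -/
def IsElem (t : Finset (Fin (n + 3))) : Element n → Prop
  | Sum.inl (x, y) => x ∈ t ∧ y ∈ t ∧ x ≠ y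
  | Sum.inr t' => t' = t

theorem face_rotate (a b c : Fin (n + 3)) : (face b c a : Element n) = face a b c :=
  congrArg Sum.inr (triple_rotate a b c)

theorem face_swap (a b c : Fin (n + 3)) : (face a c b : Element n) = face a b c :=
  congrArg Sum.inr (triple_swap a b c)

theorem triArrows_eq (a b c : Fin (n + 3)) :
    triArrows a b c =
      [(face a b c, edge a b), (edge a b, edge a c), (edge a c, face a b c),
        (face a b c, edge b c), (edge b c, edge b a), (edge b a, face a b c),
        (face a b c, edge c a), (edge c a, edge c b), (edge c b, face a b c)] := by
  simp only [triArrows, cornerArrows, face_rotate a b c, ← face_rotate c a b,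
    List.cons_append, List.nil_append]

theorem arrowMatrix_rotate (a b c : Fin (n + 3)) :
    arrowMatrix (triArrows b c a) = arrowMatrix (triArrows a b c) := by
  have h : (triArrows b c a).Perm (triArrows a b c) := by
    unfold triArrows
    exact List.perm_append_comm.trans (by rw [List.append_assoc])
  ext e e'
  simp only [arrowMatrix, h.count_eq]

theorem triMatrix_rotate (a b c : Fin (n + 3)) (e e' : Element n) :
    triMatrix b c a e e' = triMatrix a b c e e' := by
  simp only [triMatrix, orient_rotate a b c, arrowMatrix_rotate a b c]

/-- Swapping two vertices reverses every arrow and also the orientation sign. Together with rotation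
invariance this makes the signed matrix depend only on the set of vertices. -/
theorem triMatrix_swap {a b c : Fin (n + 3)} (hab : a ≠ b) (hac : a ≠ c) (hbc : b ≠ c)
    (e e' : Element n) : triMatrix a c b e e' = triMatrix a b c e e' := by
  have h : ((triArrows a b c).map Prod.swap).Perm (triArrows a c b) := by
    rw [triArrows_eq, triArrows_eq, face_swap]
    simp only [List.map_cons, List.map_nil, Prod.swap_prod_mk]
    rw [List.perm_iff_count]
    intro q
    simp only [List.count_cons, List.count_nil]
    ring
  have h' : ∀ e e', (triArrows a c b).count (e, e') = (triArrows a b c).count (e', e) := by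
    intro e e'
    rw [← h.count_eq, show (e, e') = Prod.swap (e', e) from rfl,
      List.count_map_of_injective _ _ Prod.swap_injective]
  simp only [triMatrix, arrowMatrix, orient_swap hab hac hbc, h', Units.val_neg]
  ring

theorem triangleMatrix_eq {a b c : Fin (n + 3)} (hab : a ≠ b) (hac : a ≠ c) (hbc : b ≠ c)
    (e e' : Element n) : triangleMatrix {a, b, c} e e' = triMatrix a b c e e' :=
  triLift_eq (F := fun a b c => triMatrix a b c e e') (fun _ _ _ _ _ _ => triMatrix_rotate _ _ _ _ _)
    (fun _ _ _ h₁ h₂ h₃ => triMatrix_swap h₁ h₂ h₃ _ _) hab hac hbc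

theorem isElem_of_mem_triArrows {a b c : Fin (n + 3)} (hab : a ≠ b) (hac : a ≠ c) (hbc : b ≠ c)
    {e e' : Element n} (h : (e, e') ∈ triArrows a b c) :
    IsElem {a, b, c} e ∧ IsElem {a, b, c} e' := by
  rw [triArrows_eq] at h
  simp only [List.mem_cons, Prod.mk.injEq, List.not_mem_nil, or_false] at h
  rcases h with ⟨rfl, rfl⟩ | ⟨rfl, rfl⟩ | ⟨rfl, rfl⟩ | ⟨rfl, rfl⟩ | ⟨rfl, rfl⟩ | ⟨rfl, rfl⟩ |
    ⟨rfl, rfl⟩ | ⟨rfl, rfl⟩ | ⟨rfl, rfl⟩ <;>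
    simp [IsElem, hab, hac, hbc, hab.symm, hac.symm, hbc.symm]

theorem triangleMatrix_eq_zero {t : Finset (Fin (n + 3))} (ht : t.card = 3) {e e' : Element n}
    (h : ¬ IsElem t e ∨ ¬ IsElem t e') : triangleMatrix t e e' = 0 := by
  obtain ⟨a, b, c, hab, hac, hbc, rfl⟩ := Finset.card_eq_three.1 ht
  rw [triangleMatrix_eq hab hac hbc, triMatrix, arrowMatrix,
    List.count_eq_zero_of_not_mem, List.count_eq_zero_of_not_mem]
  · simp
  · intro h'
    have := isElem_of_mem_triArrows hab hac hbc h'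
    tauto
  · intro h'
    have := isElem_of_mem_triArrows hab hac hbc h'
    tauto

/-! ### Quadrilaterals -/

/-- The elements of the two triangles `abc` and `acd` of a quadrilateral. -/
def quadLabel (a b c d : Fin (n + 3)) : Fin 12 → Element n :=
  ![edge a c, edge c a, face a b c, face a c d, edge a b, edge b a, edge b c, edge c b, edge c d,
    edge d c, edge d a, edge a d]

section Quad

variable {a b c d : Fin (n + 3)}

theorem quadLabel_injective (hab : a ≠ b) (hac : a ≠ c) (had : a ≠ d) (hbc : b ≠ c) (hbd : b ≠ d)
    (hcd : c ≠ d) : Function.Injective (quadLabel a b c d) := by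
  have hf : ({a, b, c} : Finset (Fin (n + 3))) ≠ {a, c, d} := fun h => by
    have : b ∈ ({a, c, d} : Finset (Fin (n + 3))) := h ▸ by simp
    simp [hab.symm, hbc, hbd] at this
  rw [← List.nodup_ofFn]
  simp [quadLabel, List.ofFn_succ, hab, hac, had, hbc, hbd, hcd, hab.symm, hac.symm, had.symm,
    hbc.symm, hcd.symm, hf]

theorem quadLabel_rotation (i : Fin 12) (hi : 4 ≤ i) :
    quadLabel b c d a (quadRotation i) = quadLabel a b c d i := by
  fin_cases i <;> first | rfl | (exact absurd hi (by decide))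

theorem quadRotation_bijective : Function.Bijective quadRotation := by
  decide +kernel

theorem isElem_quad (hab : a ≠ b) (hac : a ≠ c) (had : a ≠ d) (hbc : b ≠ c) (hcd : c ≠ d)
    (e : Element n) :
    (IsElem {a, b, c} e ∨ IsElem {a, c, d} e) ↔ ∃ i, quadLabel a b c d i = e := by
  constructor
  · rcases e with ⟨x, y⟩ | t
    · simp only [IsElem, Finset.mem_insert, Finset.mem_singleton]
      simp only [quadLabel, Fin.exists_fin_succ, Matrix.cons_val_zero, Matrix.cons_val_succ]
      simp only [Sum.inl.injEq, Prod.mk.injEq, reduceCtorEq, false_or]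
      grind
    · rintro (h | h)
      · exact ⟨2, congrArg Sum.inr h.symm⟩
      · exact ⟨3, congrArg Sum.inr h.symm⟩
  · rintro ⟨i, rfl⟩
    fin_cases i <;> simp [quadLabel, IsElem, hab, hac, had, hbc, hcd, hab.symm, hac.symm, had.symm,
      hbc.symm, hcd.symm]

theorem quadArrows_map (a b c d : Fin (n + 3)) :
    triArrows a b c ++ triArrows a c d =
      quadArrows.map (Prod.map (quadLabel a b c d) (quadLabel a b c d)) := by
  rw [triArrows_eq, triArrows_eq]
  rfl

theorem arrowMatrix_map {ι κ : Type*} [BEq ι] [LawfulBEq ι] [BEq κ] [LawfulBEq κ] {f : ι → κ}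
    (hf : Function.Injective f) (L : List (ι × ι)) (i j : ι) :
    arrowMatrix (L.map (Prod.map f f)) (f i) (f j) = arrowMatrix L i j := by
  unfold arrowMatrix
  rw [show (f i, f j) = Prod.map f f (i, j) from rfl, show (f j, f i) = Prod.map f f (j, i) from rfl,
    List.count_map_of_injective _ _ (hf.prodMap hf), List.count_map_of_injective _ _ (hf.prodMap hf)]

/-- The triangles `abc` and `acd` have equal orientation, so their arrow lists can be concatenated
under one sign, and the concatenation is the model quiver on twelve nodes. -/
theorem triangleMatrix_quad (hab : a ≠ b) (hac : a ≠ c) (had : a ≠ d) (hbc : b ≠ c) (hbd : b ≠ d)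
    (hcd : c ≠ d) (ho : orient a c d = orient a b c) (i j : Fin 12) :
    triangleMatrix {a, b, c} (quadLabel a b c d i) (quadLabel a b c d j) +
      triangleMatrix {a, c, d} (quadLabel a b c d i) (quadLabel a b c d j) =
      orient a b c * arrowMatrix quadArrows i j := by
  rw [triangleMatrix_eq hab hac hbc, triangleMatrix_eq hac had hcd, triMatrix, triMatrix, ho,
    ← mul_add, ← arrowMatrix_map (quadLabel_injective hab hac had hbc hbd hcd), ← quadArrows_map]
  simp only [arrowMatrix, List.count_append]
  push_cast
  ring

end Quad

/-! ### Positivity -/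

/-- Quotients of polynomials which are positive at `(1, …, 1)`. -/
def IsPositive (z : Ambient n) : Prop :=
  ∃ p q : MvPolynomial (Node n) ℚ, 0 < MvPolynomial.eval 1 p ∧ 0 < MvPolynomial.eval 1 q ∧
    z = algebraMap _ (Ambient n) p / algebraMap _ (Ambient n) q

theorem algebraMap_ne_zero_of_eval_pos {p : MvPolynomial (Node n) ℚ}
    (hp : 0 < MvPolynomial.eval 1 p) : algebraMap _ (Ambient n) p ≠ 0 := by
  intro h
  rw [FaithfulSMul.algebraMap_eq_zero_iff] at h
  simp [h] at hp

theorem IsPositive.ne_zero {z : Ambient n} (hz : IsPositive z) : z ≠ 0 := by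
  obtain ⟨p, q, hp, hq, rfl⟩ := hz
  exact div_ne_zero (algebraMap_ne_zero_of_eval_pos hp) (algebraMap_ne_zero_of_eval_pos hq)

theorem IsPositive.one : IsPositive (1 : Ambient n) :=
  ⟨1, 1, by simp, by simp, by simp⟩

theorem IsPositive.initialX (u : Node n) : IsPositive (initialX u) :=
  ⟨MvPolynomial.X u, 1, by simp, by simp, by simp [SL3Fan.initialX]⟩

theorem IsPositive.mul {z w : Ambient n} (hz : IsPositive z) (hw : IsPositive w) :
    IsPositive (z * w) := by
  obtain ⟨p, q, hp, hq, rfl⟩ := hz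
  obtain ⟨p', q', hp', hq', rfl⟩ := hw
  exact ⟨p * p', q * q', by simpa using mul_pos hp hp', by simpa using mul_pos hq hq', by
    rw [map_mul, map_mul, div_mul_div_comm]⟩

theorem IsPositive.add {z w : Ambient n} (hz : IsPositive z) (hw : IsPositive w) :
    IsPositive (z + w) := by
  obtain ⟨p, q, hp, hq, rfl⟩ := hz
  obtain ⟨p', q', hp', hq', rfl⟩ := hw
  refine ⟨p * q' + q * p', q * q', ?_, by simpa using mul_pos hq hq', ?_⟩
  · simpa using add_pos (mul_pos hp hq') (mul_pos hq hp')
  · rw [div_add_div _ _ (algebraMap_ne_zero_of_eval_pos hq) (algebraMap_ne_zero_of_eval_pos hq')]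
    simp

theorem IsPositive.inv {z : Ambient n} (hz : IsPositive z) : IsPositive z⁻¹ := by
  obtain ⟨p, q, hp, hq, rfl⟩ := hz
  exact ⟨q, p, hq, hp, inv_div _ _⟩

theorem IsPositive.prod_pow {ι : Type*} (S : Finset ι) {z : ι → Ambient n} (m : ι → ℕ)
    (hz : ∀ i, IsPositive (z i)) : IsPositive (∏ i ∈ S, z i ^ m i) := by
  refine Finset.prod_induction _ _ (fun _ _ => IsPositive.mul) IsPositive.one fun i _ => ?_
  induction m i with
  | zero => simpa using IsPositive.one
  | succ k ih => rw [pow_succ]; exact ih.mul (hz i)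

/-- Exchange relations are subtraction-free. This is how the variables are known to stay nonzero,
which allows the exchange relations to be divided by the old variable. -/
theorem IsPositive.mutate {s : Seed n} (hs : ∀ u, IsPositive (s.x u)) (k u : Node n) :
    IsPositive ((s.mutate k).x u) := by
  simp only [Seed.mutate]
  rcases eq_or_ne u k with rfl | huk
  · rw [Function.update_self, div_eq_mul_inv]
    exact ((IsPositive.prod_pow _ _ hs).add (IsPositive.prod_pow _ _ hs)).mul (hs u).inv
  · rw [Function.update_of_ne huk]
    exact hs u

/-! ### Configurations of flags -/

/-- Pairings `ψ a b` of covectors with vectors and determinants `D a b c` of vectors of a configuration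
of flags. -/
structure IsFlagConfiguration {V K : Type*} [Field K] (ψ : V → V → K) (D : V → V → V → K) : Prop where
  self : ∀ a, ψ a a = 0
  rotate : ∀ a b c, D b c a = D a b c
  swap : ∀ a b c, D a c b = -D a b c
  plucker : ∀ e a b c d, D b c d * ψ e a - D a c d * ψ e b + D a b d * ψ e c - D a b c * ψ e d = 0

/-- The variables of a configuration of flags. -/
noncomputable def flagVariable {K : Type*} [Field K] (ψ : Fin (n + 3) → Fin (n + 3) → K)
    (D : Fin (n + 3) → Fin (n + 3) → Fin (n + 3) → K) : Element n → K
  | Sum.inl q => ψ q.1 q.2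
  | Sum.inr t => triLift (fun a b c => ((orient a b c : ℤ) : K) * D a b c) t

section Flag

variable {K : Type*} [Field K] {ψ : Fin (n + 3) → Fin (n + 3) → K}
  {D : Fin (n + 3) → Fin (n + 3) → Fin (n + 3) → K} (hD : IsFlagConfiguration ψ D)
  {a b c d : Fin (n + 3)}

include hD in
-- The determinant is alternating and the orientation sign compensates for it, so the product
-- descends to unordered triples.
theorem flagVariable_face (hab : a ≠ b) (hac : a ≠ c) (hbc : b ≠ c) :
    flagVariable ψ D (face a b c) = ((orient a b c : ℤ) : K) * D a b c :=
  triLift_eq (F := fun a b c => ((orient a b c : ℤ) : K) * D a b c)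
    (fun a b c _ _ _ => by rw [orient_rotate a b c, hD.rotate a b c])
    (fun a b c h₁ h₂ h₃ => by
      rw [orient_swap h₁ h₂ h₃, hD.swap a b c]; push_cast; ring) hab hac hbc

include hD in
/-- The exchange relation at a directed edge. -/
theorem flagVariable_exchange_edge (hX : Crosses a c b d) :
    flagVariable ψ D (edge a c) * flagVariable ψ D (face a b d) =
      flagVariable ψ D (face a c d) * flagVariable ψ D (edge a b) +
        flagVariable ψ D (face a b c) * flagVariable ψ D (edge a d) := by
  obtain ⟨hab, hac, had, hbc, hbd, hcd⟩ := hX.ne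
  obtain ⟨h1, h2, -⟩ := hX.orient_eq
  rw [flagVariable_face hD hab had hbd, flagVariable_face hD hac had hcd,
    flagVariable_face hD hab hac hbc, h1, h2]
  simp only [flagVariable]
  -- The covector at `a` kills the vector at `a`, so the four-term relation becomes a three-term
  -- one.
  have := hD.plucker a a b c d
  rw [hD.self] at this
  linear_combination ((orient a b c : ℤ) : K) * this

include hD in
/-- The exchange relation at a face. -/
theorem flagVariable_exchange_face (hX : Crosses a c b d) :
    flagVariable ψ D (face a b c) * flagVariable ψ D (edge b d) =
      flagVariable ψ D (face b c d) * flagVariable ψ D (edge b a) +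
        flagVariable ψ D (face a b d) * flagVariable ψ D (edge b c) := by
  obtain ⟨hab, hac, had, hbc, hbd, hcd⟩ := hX.ne
  obtain ⟨-, h1, h2⟩ := hX.orient_eq
  rw [flagVariable_face hD hab had hbd, flagVariable_face hD hbc hbd hcd,
    flagVariable_face hD hab hac hbc, h1, h2]
  simp only [flagVariable]
  have := hD.plucker b a b c d
  rw [hD.self] at this
  linear_combination -((orient a b c : ℤ) : K) * this

end Flag

/-! ### Flips -/

/-- The seed `s` belongs to the triangulation `T`, and its variables are those of `X`. -/
structure IsSeedOf (ε : ℤˣ) (X : Element n → Ambient n) (s : Seed n)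
    (T : Finset (Finset (Fin (n + 3)))) : Prop where
  card : ∀ t ∈ T, t.card = 3
  not_crosses : ∀ t ∈ T, ∀ t' ∈ T, ∀ x ∈ t, ∀ y ∈ t, ∀ z ∈ t', ∀ w ∈ t', ¬ Crosses x y z w
  inj : Function.Injective s.label
  label : ∀ e, (∃ u, s.label u = e) ↔ ∃ t ∈ T, IsElem t e
  B : ∀ u v, s.B u v = ε * ∑ t ∈ T, triangleMatrix t (s.label u) (s.label v)
  x : ∀ u, s.x u = X (s.label u)
  pos : ∀ u, IsPositive (s.x u)

/-- The triangulation after a flip. -/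
def flipTriangles (T : Finset (Finset (Fin (n + 3)))) (a b c d : Fin (n + 3)) :
    Finset (Finset (Fin (n + 3))) :=
  insert {b, c, d} (insert {b, d, a} ((T.erase {a, b, c}).erase {a, c, d}))

section Flip

variable {ε : ℤˣ} {X : Element n → Ambient n} {s : Seed n} {T : Finset (Finset (Fin (n + 3)))}
  {a b c d : Fin (n + 3)}

/-- `Flip` only asks for four distinct vertices with the right labels. That `ac` and `bd` really are
the diagonals follows because no two sides of triangles of a triangulation cross. -/
theorem IsSeedOf.crosses (h : IsSeedOf ε X s T) (hab : a ≠ b) (hac : a ≠ c) (had : a ≠ d)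
    (hbc : b ≠ c) (hbd : b ≠ d) (hcd : c ≠ d) (h₁ : {a, b, c} ∈ T) (h₂ : {a, c, d} ∈ T) :
    Crosses a c b d :=
  crosses_of_not_crosses hab hac had hbc hbd hcd
    (h.not_crosses _ h₁ _ h₂ _ (by simp) _ (by simp) _ (by simp) _ (by simp))
    (h.not_crosses _ h₁ _ h₂ _ (by simp) _ (by simp) _ (by simp) _ (by simp))

/-- Only the two given triangles lie at the diagonal `ac`. -/
theorem IsSeedOf.eq_of_mem (h : IsSeedOf ε X s T) (hX : Crosses a c b d) (h₁ : {a, b, c} ∈ T)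
    (h₂ : {a, c, d} ∈ T) {t : Finset (Fin (n + 3))} (ht : t ∈ T) (ha : a ∈ t) (hc : c ∈ t) :
    t = {a, b, c} ∨ t = {a, c, d} := by
  obtain ⟨hab, hac, had, hbc, hbd, hcd⟩ := hX.ne
  obtain ⟨e, he, hea, hec⟩ : ∃ e ∈ t, e ≠ a ∧ e ≠ c := by
    by_contra! hcon
    have : t ⊆ {a, c} := fun e he => by
      by_cases hea : e = a
      · simp [hea]
      · simp [hcon e he hea]
    have h' := Finset.card_le_card this
    rw [h.card t ht] at h'
    exact absurd (h'.trans (Finset.card_le_two)) (by decide)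
  have key : ∀ e', {a, e', c} ∈ T → e' = e → t = {a, e', c} := by
    rintro e' he' rfl
    symm
    apply Finset.eq_of_subset_of_card_le
    · intro z hz
      simp only [Finset.mem_insert, Finset.mem_singleton] at hz
      rcases hz with rfl | rfl | rfl <;> assumption
    · rw [h.card _ ht, h.card _ he']
  by_cases heb : e = b
  · exact Or.inl (key b h₁ heb.symm)
  by_cases hed : e = d
  · right
    rw [← triple_swap a c d] at h₂ ⊢
    exact key d h₂ hed.symm
  rcases hX.third_triangle hea heb hec hed with h' | h' | h' | h'
  · exact absurd h' (h.not_crosses _ ht _ h₁ _ ha _ he _ (by simp) _ (by simp))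
  · exact absurd h' (h.not_crosses _ ht _ h₁ _ he _ hc _ (by simp) _ (by simp))
  · exact absurd h' (h.not_crosses _ ht _ h₂ _ ha _ he _ (by simp) _ (by simp))
  · exact absurd h' (h.not_crosses _ ht _ h₂ _ he _ hc _ (by simp) _ (by simp))

theorem IsSeedOf.not_mem_diagonal (h : IsSeedOf ε X s T) (hX : Crosses a c b d)
    (h₁ : {a, b, c} ∈ T) (h₂ : {a, c, d} ∈ T) {t : Finset (Fin (n + 3))}
    (ht : t ∈ (T.erase {a, b, c}).erase {a, c, d}) : ¬ (a ∈ t ∧ c ∈ t) := by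
  rintro ⟨ha, hc⟩
  simp only [Finset.mem_erase] at ht
  rcases h.eq_of_mem hX h₁ h₂ ht.2.2 ha hc with h' | h'
  · exact ht.2.1 h'
  · exact ht.1 h'

/-- Each pair of vertices of a new triangle is either a pair from an old triangle other than the
diagonal `ac`, or `bd` itself. An old chord that crosses `bd` would cross a side of the
quadrilateral unless it is `ac`. -/
theorem IsSeedOf.not_crosses_flip (h : IsSeedOf ε X s T) (hX : Crosses a c b d)
    (h₁ : {a, b, c} ∈ T) (h₂ : {a, c, d} ∈ T) {t t' : Finset (Fin (n + 3))}
    (ht : t ∈ flipTriangles T a b c d) (ht' : t' ∈ flipTriangles T a b c d)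
    {x y z w : Fin (n + 3)} (hx : x ∈ t) (hy : y ∈ t) (hz : z ∈ t') (hw : w ∈ t') :
    ¬ Crosses x y z w := by
  obtain ⟨hab, hac, had, hbc, hbd, hcd⟩ := hX.ne
  have key : ∀ t ∈ flipTriangles T a b c d, ∀ x ∈ t, ∀ y ∈ t,
      ((∃ t₀ ∈ T, x ∈ t₀ ∧ y ∈ t₀) ∧ ¬ (x = a ∧ y = c) ∧ ¬ (x = c ∧ y = a)) ∨
        (x = b ∧ y = d) ∨ (x = d ∧ y = b) := by
    intro t ht x hx y hy
    simp only [flipTriangles, Finset.mem_insert] at ht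
    rcases ht with rfl | rfl | ht
    · simp only [Finset.mem_insert, Finset.mem_singleton] at hx hy
      by_cases h' : x ≠ d ∧ y ≠ d
      · exact Or.inl ⟨⟨_, h₁, by simp; tauto, by simp; tauto⟩, by grind, by grind⟩
      by_cases h'' : x ≠ b ∧ y ≠ b
      · exact Or.inl ⟨⟨_, h₂, by simp; tauto, by simp; tauto⟩, by grind, by grind⟩
      · grind
    · simp only [Finset.mem_insert, Finset.mem_singleton] at hx hy
      by_cases h' : x ≠ d ∧ y ≠ d
      · exact Or.inl ⟨⟨_, h₁, by simp; tauto, by simp; tauto⟩, by grind, by grind⟩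
      by_cases h'' : x ≠ b ∧ y ≠ b
      · exact Or.inl ⟨⟨_, h₂, by simp; tauto, by simp; tauto⟩, by grind, by grind⟩
      · grind
    · have hd := h.not_mem_diagonal hX h₁ h₂ ht
      exact Or.inl ⟨⟨t, Finset.mem_of_mem_erase (Finset.mem_of_mem_erase ht), hx, hy⟩,
        fun h' => hd ⟨h'.1 ▸ hx, h'.2 ▸ hy⟩, fun h' => hd ⟨h'.2 ▸ hy, h'.1 ▸ hx⟩⟩
  have side : ∀ x y, ((∃ t₀ ∈ T, x ∈ t₀ ∧ y ∈ t₀) ∧ ¬ (x = a ∧ y = c) ∧ ¬ (x = c ∧ y = a)) →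
      ¬ Crosses x y b d := by
    rintro x y ⟨⟨t₀, ht₀, hx, hy⟩, hn₁, hn₂⟩ hxy
    rcases hX.crosses_side hxy with h' | h' | h' | h' | h' | h'
    · exact h.not_crosses _ ht₀ _ h₁ _ hx _ hy _ (by simp) _ (by simp) h'
    · exact h.not_crosses _ ht₀ _ h₁ _ hx _ hy _ (by simp) _ (by simp) h'
    · exact h.not_crosses _ ht₀ _ h₂ _ hx _ hy _ (by simp) _ (by simp) h'
    · exact h.not_crosses _ ht₀ _ h₂ _ hx _ hy _ (by simp) _ (by simp) h'
    · exact hn₁ h'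
    · exact hn₂ h'
  intro hc
  rcases key t ht x hx y hy with hxy | ⟨rfl, rfl⟩ | ⟨rfl, rfl⟩ <;>
    rcases key t' ht' z hz w hw with hzw | ⟨rfl, rfl⟩ | ⟨rfl, rfl⟩
  · obtain ⟨⟨t₀, ht₀, hx, hy⟩, -⟩ := hxy
    obtain ⟨⟨t₁, ht₁, hz, hw⟩, -⟩ := hzw
    exact h.not_crosses _ ht₀ _ ht₁ _ hx _ hy _ hz _ hw hc
  · exact side _ _ hxy hc
  · exact side _ _ hxy hc.symm.left_comm.symm
  · exact side _ _ hzw hc.symm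
  · exact hc.ne.1 rfl
  · exact hc.ne.2.2.1 rfl
  · exact side _ _ hzw hc.left_comm.symm
  · exact hc.ne.2.2.1 rfl
  · exact hc.ne.1 rfl

/-- The elements inside a quadrilateral do not belong to the other triangles. -/
theorem not_isElem_quadLabel {t : Finset (Fin (n + 3))} (h : ¬ (a ∈ t ∧ c ∈ t)) {i : Fin 12}
    (hi : i < 4) : ¬ IsElem t (quadLabel a b c d i) := by
  have : i = 0 ∨ i = 1 ∨ i = 2 ∨ i = 3 := by revert i; decide
  rcases this with rfl | rfl | rfl | rfl
  · exact fun h' => h ⟨h'.1, h'.2.1⟩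
  · exact fun h' => h ⟨h'.2.1, h'.1⟩
  · rintro rfl
    exact h ⟨by simp, by simp⟩
  · rintro rfl
    exact h ⟨by simp, by simp⟩

theorem quadRotation_lt (i : Fin 12) : quadRotation i < 4 ↔ i < 4 := by
  revert i; decide +kernel

/-- The elements of a triangulation with a quadrilateral `abcd`. -/
theorem exists_isElem_insert_quad {T₀ : Finset (Finset (Fin (n + 3)))} (hX : Crosses a c b d)
    (e : Element n) :
    (∃ t ∈ insert {a, b, c} (insert {a, c, d} T₀), IsElem t e) ↔
      (∃ t ∈ T₀, IsElem t e) ∨ ∃ i, quadLabel a b c d i = e := by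
  obtain ⟨hab, hac, had, hbc, hbd, hcd⟩ := hX.ne
  rw [← isElem_quad hab hac had hbc hcd]
  simp only [Finset.mem_insert, exists_eq_or_imp]
  rw [← or_assoc, or_comm]

/-- The invariant behind the whole argument: once the exchange relations hold for `X`, a flip leads
from a seed with values `X` to a seed with values `X`. Only the four nodes inside the quadrilateral
change their labels, and they have no arrows to the other triangles. -/
theorem IsSeedOf.flip (h : IsSeedOf ε X s T)
    (hedge : ∀ a b c d, Crosses a c b d →
      X (edge a c) * X (face a b d) =
        X (face a c d) * X (edge a b) + X (face a b c) * X (edge a d))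
    (hface : ∀ a b c d, Crosses a c b d →
      X (face a b c) * X (edge b d) =
        X (face b c d) * X (edge b a) + X (face a b d) * X (edge b c))
    (hX : Crosses a c b d) (h₁ : {a, b, c} ∈ T)
    (h₂ : {a, c, d} ∈ T) {u₁ u₂ u₃ u₄ : Node n} (hu₁ : s.label u₁ = edge a c)
    (hu₂ : s.label u₂ = edge c a) (hu₃ : s.label u₃ = face a b c) (hu₄ : s.label u₄ = face a c d) :
    IsSeedOf ε X { (((s.mutate u₁).mutate u₂).mutate u₃).mutate u₄ with
        label := Function.update (Function.update (Function.update (Function.update s.label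
          u₁ (face a b d)) u₂ (face b c d)) u₃ (edge b d)) u₄ (edge d b) }
      (flipTriangles T a b c d) := by
  obtain ⟨hab, hac, had, hbc, hbd, hcd⟩ := hX.ne
  have hX' : Crosses b d c a := hX.rotate
  set T₀ := (T.erase {a, b, c}).erase {a, c, d} with hT₀
  have hne : ({a, b, c} : Finset (Fin (n + 3))) ≠ {a, c, d} := fun h => by
    have : b ∈ ({a, c, d} : Finset (Fin (n + 3))) := h ▸ by simp
    simp [hab.symm, hbc, hbd] at this
  have hT : T = insert {a, b, c} (insert {a, c, d} T₀) := by
    rw [hT₀, Finset.insert_erase (Finset.mem_erase.2 ⟨hne.symm, h₂⟩), Finset.insert_erase h₁]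
  have hsub : T₀ ⊆ T := by rw [hT]; exact (Finset.subset_insert _ _).trans (Finset.subset_insert _ _)
  have hac₀ : ∀ t ∈ T₀, ¬ (a ∈ t ∧ c ∈ t) := fun t ht => h.not_mem_diagonal hX h₁ h₂ ht
  have hbdT : ∀ t ∈ T, ¬ (b ∈ t ∧ d ∈ t) := fun t ht h' =>
    h.not_crosses _ h₁ _ ht _ (by simp) _ (by simp) _ h'.1 _ h'.2 hX
  have hσ := quadLabel_injective hab hac had hbc hbd hcd
  have hσ' := quadLabel_injective hbc hbd hab.symm hcd hac.symm had.symm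
  -- the twelve nodes of the quadrilateral
  have hex : ∀ i, ∃ u, s.label u = quadLabel a b c d i := fun i => by
    rw [h.label, hT, exists_isElem_insert_quad hX]
    exact Or.inr ⟨i, rfl⟩
  choose τ hτ using hex
  have hτi : Function.Injective τ := fun i j hij => hσ (by rw [← hτ, ← hτ, hij])
  obtain rfl : u₁ = τ 0 := h.inj (by rw [hτ, hu₁]; rfl)
  obtain rfl : u₂ = τ 1 := h.inj (by rw [hτ, hu₂]; rfl)
  obtain rfl : u₃ = τ 2 := h.inj (by rw [hτ, hu₃]; rfl)
  obtain rfl : u₄ = τ 3 := h.inj (by rw [hτ, hu₄]; rfl)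
  set l := Function.update (Function.update (Function.update (Function.update s.label
          (τ 0) (face a b d)) (τ 1) (face b c d)) (τ 2) (edge b d)) (τ 3) (edge d b) with hl
  have hlτ : ∀ i, l (τ i) = quadLabel b c d a (quadRotation i) := by
    intro i
    by_cases hi : 4 ≤ i
    · rw [hl, Function.update_of_ne (hτi.ne (by rintro rfl; revert hi; decide)),
        Function.update_of_ne (hτi.ne (by rintro rfl; revert hi; decide)),
        Function.update_of_ne (hτi.ne (by rintro rfl; revert hi; decide)),
        Function.update_of_ne (hτi.ne (by rintro rfl; revert hi; decide)), hτ,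
        quadLabel_rotation i hi]
    · have : i = 0 ∨ i = 1 ∨ i = 2 ∨ i = 3 := by revert i; decide
      rcases this with rfl | rfl | rfl | rfl
      · rw [hl, Function.update_of_ne (hτi.ne (by decide)),
          Function.update_of_ne (hτi.ne (by decide)), Function.update_of_ne (hτi.ne (by decide)),
          Function.update_self]
        exact (face_rotate a b d).symm
      · rw [hl, Function.update_of_ne (hτi.ne (by decide)),
          Function.update_of_ne (hτi.ne (by decide)), Function.update_self]
        rfl
      · rw [hl, Function.update_of_ne (hτi.ne (by decide)), Function.update_self]
        rfl
      · rw [hl, Function.update_self]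
        rfl
  have hl_old : ∀ u, (∀ i < 4, u ≠ τ i) → l u = s.label u := fun u hu => by
    rw [hl, Function.update_of_ne (hu 3 (by decide)), Function.update_of_ne (hu 2 (by decide)),
      Function.update_of_ne (hu 1 (by decide)), Function.update_of_ne (hu 0 (by decide))]
  have hl_off : ∀ u, u ∉ Set.range τ → l u = s.label u := fun u hu =>
    hl_old u fun i _ h' => hu ⟨i, h'.symm⟩
  -- The new labels involve both `b` and `d`, and `bd` crosses `ac`, so none of them was present
  -- before the flip.
  have hnew : ∀ i < 4, ∀ u, s.label u ≠ quadLabel b c d a (quadRotation i) := fun i hi u hu => by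
    obtain ⟨t, ht, hte⟩ := (h.label _).1 ⟨u, hu⟩
    exact not_isElem_quadLabel (hbdT t ht) ((quadRotation_lt i).2 hi) hte
  have hlinj : Function.Injective l := by
    have key : ∀ u v, u ∈ Set.range τ → l u = l v → u = v := by
      rintro _ v ⟨i, rfl⟩ huv
      by_cases hv : v ∈ Set.range τ
      · obtain ⟨j, rfl⟩ := hv
        rw [hlτ, hlτ] at huv
        rw [quadRotation_bijective.1 (hσ' huv)]
      · rw [hl_off v hv, hlτ] at huv
        by_cases hi : i < 4
        · exact absurd huv.symm (hnew i hi v)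
        · rw [quadLabel_rotation i (not_lt.1 hi), ← hτ] at huv
          exact h.inj huv
    intro u v huv
    by_cases hu : u ∈ Set.range τ
    · exact key u v hu huv
    by_cases hv : v ∈ Set.range τ
    · exact (key v u hv huv.symm).symm
    · rw [hl_off u hu, hl_off v hv] at huv
      exact h.inj huv
  have hT' : flipTriangles T a b c d = insert {b, c, d} (insert {b, d, a} T₀) := rfl
  have hcard₀ : ∀ t ∈ T₀, t.card = 3 := fun t ht => h.card t (hsub ht)
  have hne' : ({b, c, d} : Finset (Fin (n + 3))) ≠ {b, d, a} := fun h => by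
    have : c ∈ ({b, d, a} : Finset (Fin (n + 3))) := h ▸ by simp
    simp [hcd, hbc.symm, hac.symm] at this
  have hn₁ : ({b, c, d} : Finset (Fin (n + 3))) ∉ insert {b, d, a} T₀ := by
    simp only [Finset.mem_insert, not_or]
    exact ⟨hne', fun h' => hbdT _ (hsub h') (by simp)⟩
  have hn₂ : ({b, d, a} : Finset (Fin (n + 3))) ∉ T₀ := fun h' => hbdT _ (hsub h') (by simp)
  have hm₁ : ({a, b, c} : Finset (Fin (n + 3))) ∉ insert {a, c, d} T₀ := by
    simp only [Finset.mem_insert, not_or]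
    exact ⟨hne, fun h' => hac₀ _ h' (by simp)⟩
  have hm₂ : ({a, c, d} : Finset (Fin (n + 3))) ∉ T₀ := fun h' => hac₀ _ h' (by simp)
  -- the part of the quiver outside the quadrilateral
  set O : Node n → Node n → ℤ := fun u v =>
    ε * ∑ t ∈ T₀, triangleMatrix t (s.label u) (s.label v) with hO
  have hO₀ : ∀ k : Fin 12, k < 4 → ∀ u, O u (τ k) = 0 ∧ O (τ k) u = 0 := by
    intro k hk u
    simp only [hO, hτ]
    constructor
    · rw [Finset.sum_eq_zero, mul_zero]
      exact fun t ht => triangleMatrix_eq_zero (hcard₀ t ht)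
        (Or.inr (not_isElem_quadLabel (hac₀ t ht) hk))
    · rw [Finset.sum_eq_zero, mul_zero]
      exact fun t ht => triangleMatrix_eq_zero (hcard₀ t ht)
        (Or.inl (not_isElem_quadLabel (hac₀ t ht) hk))
  -- Relabelling leaves the background alone: the four relabelled nodes lie on no triangle of `T₀`,
  -- before the flip and after it.
  have hO' : ∀ u v, O u v = ε * ∑ t ∈ T₀, triangleMatrix t (l u) (l v) := by
    have key : ∀ u, (∃ i < 4, u = τ i) ∨ l u = s.label u := fun u => by
      by_cases hu : ∃ i < 4, u = τ i
      · exact Or.inl hu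
      · push Not at hu
        exact Or.inr (hl_old u hu)
    intro u v
    rcases key u with ⟨i, hi, rfl⟩ | hu
    · rw [(hO₀ i hi v).2, Finset.sum_eq_zero, mul_zero]
      intro t ht
      rw [hlτ]
      exact triangleMatrix_eq_zero (hcard₀ t ht) (Or.inl
        (not_isElem_quadLabel (hbdT t (hsub ht)) ((quadRotation_lt i).2 hi)))
    rcases key v with ⟨i, hi, rfl⟩ | hv
    · rw [(hO₀ i hi u).1, Finset.sum_eq_zero, mul_zero]
      intro t ht
      rw [hlτ i]
      exact triangleMatrix_eq_zero (hcard₀ t ht) (Or.inr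
        (not_isElem_quadLabel (hbdT t (hsub ht)) ((quadRotation_lt i).2 hi)))
    · rw [hu, hv]
  obtain ⟨ho₁, ho₂, ho₃⟩ := hX.orient_eq
  obtain ⟨ho₄, -, -⟩ := hX'.orient_eq
  -- The quadrilateral may be named in either cyclic sense; its orientation is absorbed into the
  -- global sign.
  have hloc : IsLocally O s.x τ
      (fun i j => ((ε * orient a b c : ℤˣ) : ℤ) * arrowMatrix quadArrows i j)
      (fun i => X (quadLabel a b c d i)) s := by
    refine ⟨fun i j => ?_, fun u v huv => ?_, fun i => ?_, fun _ _ => rfl⟩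
    · rw [h.B, hT, Finset.sum_insert hm₁, Finset.sum_insert hm₂, ← add_assoc, hτ, hτ,
        triangleMatrix_quad hab hac had hbc hbd hcd ho₁]
      simp only [hO, hτ]
      push_cast
      ring
    · have key : ∀ u, u ∉ Set.range τ →
          ¬ (IsElem {a, b, c} (s.label u) ∨ IsElem {a, c, d} (s.label u)) := by
        intro u hu
        rw [isElem_quad hab hac had hbc hcd]
        rintro ⟨i, hi⟩
        exact hu ⟨i, h.inj (by rw [hτ, hi])⟩
      rw [h.B, hT, Finset.sum_insert hm₁, Finset.sum_insert hm₂,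
        triangleMatrix_eq_zero (h.card _ h₁), triangleMatrix_eq_zero (h.card _ h₂), zero_add,
        zero_add]
      · exact huv.imp (fun hu h' => key u hu (Or.inr h')) fun hv h' => key v hv (Or.inr h')
      · exact huv.imp (fun hu h' => key u hu (Or.inl h')) fun hv h' => key v hv (Or.inl h')
    · rw [h.x, hτ]
  have hXne : ∀ i, X (quadLabel a b c d i) ≠ 0 := fun i => by
    rw [← hτ, ← h.x]; exact (h.pos _).ne_zero
  have hflip := hloc.flip hτi (z := fun i => X (quadLabel b c d a (quadRotation i))) _ hO₀
    (fun i hi => by rw [quadLabel_rotation i hi])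
    (by
      rw [eq_div_iff (hXne 0), mul_comm]
      have := hedge a b c d hX
      rw [← face_rotate a b d] at this
      exact this)
    (by
      rw [eq_div_iff (hXne 1), mul_comm]
      -- The mutation at `c → a` is the one at `a → c` for the quadrilateral turned by two steps;
      -- likewise for the second face below.
      have := hedge c d a b hX.rotate.rotate
      rw [face_rotate b c d, face_rotate b c a, face_rotate a b c, face_rotate a c d] at this
      exact this)
    (by
      rw [eq_div_iff (hXne 2), mul_comm]
      have := hface a b c d hX
      rw [← face_rotate a b d] at this
      exact this)
    (by
      rw [eq_div_iff (hXne 3), mul_comm]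
      have := hface c d a b hX.rotate.rotate
      rw [face_rotate b c d, face_rotate b d a, face_rotate a c d] at this
      exact this)
  refine ⟨?_, ?_, hlinj, ?_, ?_, ?_, ?_⟩
  · intro t ht
    rw [hT', Finset.mem_insert, Finset.mem_insert] at ht
    rcases ht with rfl | rfl | ht
    · exact Finset.card_eq_three.2 ⟨b, c, d, hbc, hbd, hcd, rfl⟩
    · exact Finset.card_eq_three.2 ⟨b, d, a, hbd, hab.symm, had.symm, rfl⟩
    · exact hcard₀ t ht
  · exact fun t ht t' ht' x hx y hy z hz w hw => h.not_crosses_flip hX h₁ h₂ ht ht' hx hy hz hw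
  · intro e
    rw [hT', exists_isElem_insert_quad hX']
    constructor
    · rintro ⟨u, rfl⟩
      change (∃ t ∈ T₀, IsElem t (l u)) ∨ ∃ i, quadLabel b c d a i = l u
      by_cases hu : u ∈ Set.range τ
      · obtain ⟨i, rfl⟩ := hu
        exact Or.inr ⟨_, (hlτ i).symm⟩
      · have := (h.label (s.label u)).1 ⟨u, rfl⟩
        rw [hT, exists_isElem_insert_quad hX] at this
        rw [hl_off u hu]
        rcases this with h' | ⟨i, hi⟩
        · exact Or.inl h'
        · exact absurd ⟨i, h.inj (by rw [hτ, hi])⟩ hu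
    · rintro (⟨t, ht, hte⟩ | ⟨i, rfl⟩)
      · obtain ⟨u, rfl⟩ := (h.label e).2 ⟨t, hsub ht, hte⟩
        refine ⟨u, hl_old u ?_⟩
        rintro i hi rfl
        rw [hτ] at hte
        exact not_isElem_quadLabel (hac₀ t ht) hi hte
      · obtain ⟨j, rfl⟩ := quadRotation_bijective.2 i
        exact ⟨τ j, hlτ j⟩
  · intro u v
    change _ = (ε : ℤ) * ∑ t ∈ flipTriangles T a b c d, triangleMatrix t (l u) (l v)
    rw [hT', Finset.sum_insert hn₁, Finset.sum_insert hn₂, ← add_assoc, mul_add, ← hO']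
    by_cases huv : u ∉ Set.range τ ∨ v ∉ Set.range τ
    · have key : ∀ u, u ∉ Set.range τ →
          ¬ (IsElem {b, c, d} (l u) ∨ IsElem {b, d, a} (l u)) := by
        intro u hu
        rw [isElem_quad hbc hbd hab.symm hcd had.symm]
        rintro ⟨i, hi⟩
        obtain ⟨j, rfl⟩ := quadRotation_bijective.2 i
        exact hu ⟨j, hlinj (by rw [hlτ, hi])⟩
      rw [triangleMatrix_eq_zero (Finset.card_eq_three.2 ⟨b, c, d, hbc, hbd, hcd, rfl⟩),
        triangleMatrix_eq_zero (Finset.card_eq_three.2 ⟨b, d, a, hbd, hab.symm, had.symm, rfl⟩)]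
      · simpa using hflip.off u v huv
      · exact huv.imp (fun hu h' => key u hu (Or.inr h')) fun hv h' => key v hv (Or.inr h')
      · exact huv.imp (fun hu h' => key u hu (Or.inl h')) fun hv h' => key v hv (Or.inl h')
    · push Not at huv
      obtain ⟨⟨i, rfl⟩, j, rfl⟩ := huv
      rw [hlτ, hlτ, triangleMatrix_quad hbc hbd hab.symm hcd hac.symm had.symm ho₄, ho₃]
      have := hflip.on i j
      refine this.trans ?_
      push_cast
      ring
  · intro u
    change _ = X (l u)
    by_cases hu : u ∈ Set.range τ
    · obtain ⟨i, rfl⟩ := hu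
      rw [hlτ]
      exact hflip.var i
    · rw [hl_off u hu, ← h.x]
      exact hflip.var_off u hu
  · exact fun u => IsPositive.mutate (IsPositive.mutate (IsPositive.mutate
      (IsPositive.mutate h.pos _) _) _) _ u

end Flip

/-! ### The configuration of flags of a fan triangulation -/

/-- Coordinates on configurations of flags with respect to a fan triangulation with fan vertex `f`:
`x k` on `f → p_k`, `g k` on `p_k → f`, `F k` on the face `f p_k p_{k+1}`, `up k` on `p_k → p_{k+1}` and
`dn k` on `p_k → p_{k-1}`. -/
structure FanCoordinates (K : Type*) where
  x : ℕ → K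
  g : ℕ → K
  F : ℕ → K
  up : ℕ → K
  dn : ℕ → K

namespace FanCoordinates

variable {K : Type*} [Field K] (C : FanCoordinates K)

/-- The width of the `k`-th triangle in the affine chart given by `f`. -/
def width (k : ℕ) : K := C.F k / (C.x k * C.x (k + 1))

/-- The slope of the edge `p_k p_{k+1}`. -/
def slope (k : ℕ) : K :=
  ∑ l ∈ Finset.range k,
    C.x (l + 1) / C.g (l + 1) * (C.dn (l + 1) / C.F l + C.up (l + 1) / C.F (l + 1))

/-- The first affine coordinate of `p_k`. -/
def abscissa (k : ℕ) : K := ∑ j ∈ Finset.range k, C.width j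

/-- The second affine coordinate of `p_k`. -/
def ordinate (k : ℕ) : K := ∑ j ∈ Finset.range k, C.width j * C.slope j

/-- The first coordinate of the covector at `p_k`. -/
def coslope (k : ℕ) : K := C.up k * C.x k / C.F k - C.g k * C.slope k

/-- The vectors at the vertices of the polygon. -/
def vector : ℕ → K × K × K
  | 0 => (0, 0, 1)
  | k + 1 => (C.x k, C.x k * C.abscissa k, C.x k * C.ordinate k)

/-- The covectors at the vertices of the polygon. -/
def covector : ℕ → K × K × K
  | 0 => (1, 0, 0)
  | k + 1 => (-(C.coslope k * C.abscissa k + C.g k * C.ordinate k), C.coslope k, C.g k)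

/-- The pairing of a covector with a vector. -/
def pairing (a b : ℕ) : K :=
  (C.covector a).1 * (C.vector b).1 + (C.covector a).2.1 * (C.vector b).2.1 +
    (C.covector a).2.2 * (C.vector b).2.2

/-- The determinant of three vectors. -/
def det (a b c : ℕ) : K :=
  (C.vector a).1 * ((C.vector b).2.1 * (C.vector c).2.2 - (C.vector b).2.2 * (C.vector c).2.1) -
    (C.vector a).2.1 * ((C.vector b).1 * (C.vector c).2.2 - (C.vector b).2.2 * (C.vector c).1) +
    (C.vector a).2.2 * ((C.vector b).1 * (C.vector c).2.1 - (C.vector b).2.1 * (C.vector c).1)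

/-- Each axiom is a polynomial identity in the coordinates; `plucker` is Cramer's rule for four
vectors in three-space, paired with a covector. -/
theorem isFlagConfiguration {V : Type*} (f : V → ℕ) :
    IsFlagConfiguration (fun a b => C.pairing (f a) (f b))
      (fun a b c => C.det (f a) (f b) (f c)) where
  self a := by
    rcases f a with _ | k
    · simp [pairing, covector, vector]
    · simp only [pairing, covector, vector]
      ring
  rotate a b c := by
    simp only [det]
    ring
  swap a b c := by
    simp only [det]
    ring
  plucker e a b c d := by
    simp only [det, pairing]
    ring

theorem pairing_zero_succ (k : ℕ) : C.pairing 0 (k + 1) = C.x k := by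
  simp [pairing, covector, vector]

theorem pairing_succ_zero (k : ℕ) : C.pairing (k + 1) 0 = C.g k := by
  simp [pairing, covector, vector]

variable {C}

/-- The determinant is `x_k x_{k+1}` times the difference of the abscissae, which forces the
definition of `width`. -/
theorem det_zero_succ (hx : ∀ k, C.x k ≠ 0) (k : ℕ) : C.det 0 (k + 1) (k + 2) = C.F k := by
  have := hx k
  have := hx (k + 1)
  simp only [det, vector, abscissa, Finset.sum_range_succ, width]
  field_simp
  ring

/-- The pairing is `x_{k+1}` times the width times `coslope k + g k * slope k`; this forces the
definition of `coslope`. -/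
theorem pairing_succ_succ (hx : ∀ k, C.x k ≠ 0) (hF : ∀ k, C.F k ≠ 0) (k : ℕ) :
    C.pairing (k + 1) (k + 2) = C.up k := by
  have := hx k
  have := hx (k + 1)
  have := hF k
  simp only [pairing, vector, covector, abscissa, ordinate, coslope, Finset.sum_range_succ, width]
  field_simp
  ring

/-- With `coslope` already fixed by `up`, the value `dn` forces the increment of the slope at
`p_{k+1}`. The identity `hc` isolates this increment. -/
theorem pairing_succ_pred (hx : ∀ k, C.x k ≠ 0) (hg : ∀ k, C.g k ≠ 0) (hF : ∀ k, C.F k ≠ 0)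
    (k : ℕ) : C.pairing (k + 2) (k + 1) = C.dn (k + 1) := by
  have := hx k
  have := hx (k + 1)
  have := hg (k + 1)
  have := hF k
  have := hF (k + 1)
  have hs : C.slope (k + 1) = C.slope k + C.x (k + 1) / C.g (k + 1) *
      (C.dn (k + 1) / C.F k + C.up (k + 1) / C.F (k + 1)) := Finset.sum_range_succ _ _
  have hc : C.coslope (k + 1) + C.g (k + 1) * C.slope k = -(C.dn (k + 1) * C.x (k + 1) / C.F k) := by
    rw [coslope, hs]
    field_simp
    ring
  have : C.pairing (k + 2) (k + 1) =
      -(C.x k * C.width k * (C.coslope (k + 1) + C.g (k + 1) * C.slope k)) := by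
    simp only [pairing, vector, covector, abscissa, ordinate, Finset.sum_range_succ]
    ring
  rw [this, hc, width]
  field_simp

/-- The factors of the terms of the longest edge: the contribution of the second coordinate. -/
def term (C : FanCoordinates K) (m : ℕ) : K :=
  if m % 2 = 0 then C.g 0 * C.x (m / 2) * C.up (m / 2) / (C.g (m / 2) * C.F (m / 2))
  else C.g 0 * C.x (m / 2 + 1) * C.dn (m / 2 + 1) / (C.g (m / 2 + 1) * C.F (m / 2))

/-- Each increment of the slope has two summands, listed as an odd and then an even index. In this
order consecutive terms will differ by a single `ŷ`. -/
theorem sum_term (hg : ∀ k, C.g k ≠ 0) (k : ℕ) :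
    ∑ m ∈ Finset.range (2 * k + 1), C.term m = C.up 0 * C.x 0 / C.F 0 + C.g 0 * C.slope k := by
  induction k with
  | zero =>
    have := hg 0
    simp only [term, slope, Finset.range_zero, Finset.sum_empty, mul_zero, zero_add,
      Finset.range_one, Finset.sum_singleton, Nat.zero_mod, if_true, Nat.zero_div, add_zero]
    field_simp
  | succ k ih =>
    have h1 : (2 * k + 1) % 2 = 1 := by omega
    have h2 : (2 * k + 1) / 2 = k := by omega
    have h3 : (2 * k + 1 + 1) % 2 = 0 := by omega
    have h4 : (2 * k + 1 + 1) / 2 = k + 1 := by omega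
    rw [show 2 * (k + 1) + 1 = 2 * k + 1 + 1 + 1 by ring, Finset.sum_range_succ,
      Finset.sum_range_succ, ih, slope, slope, Finset.sum_range_succ]
    simp only [term, h1, h2, h3, h4, one_ne_zero, if_true, if_false]
    ring

/-- With `p_0` at the origin of the chart, the pairing is `x_k` times a linear form in the abscissa
and ordinate of `p_k`. Both are sums of widths, the second weighted by slopes, so each width
multiplies a partial sum of `term`. -/
theorem pairing_one (hg : ∀ k, C.g k ≠ 0) (k : ℕ) :
    C.pairing 1 (k + 1) =
      ∑ j ∈ Finset.range k, ∑ m ∈ Finset.range (2 * j + 1), C.x k * C.width j * C.term m := by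
  simp only [← Finset.mul_sum, sum_term hg]
  have h : ∀ j, C.x k * C.width j * (C.up 0 * C.x 0 / C.F 0 + C.g 0 * C.slope j) =
      C.x k * (C.up 0 * C.x 0 / C.F 0) * C.width j +
        C.x k * C.g 0 * (C.width j * C.slope j) := fun j => by ring
  simp only [h, Finset.sum_add_distrib, ← Finset.mul_sum]
  simp only [pairing, covector, vector, coslope]
  rw [show C.slope 0 = 0 from rfl, show C.abscissa 0 = 0 from rfl, show C.ordinate 0 = 0 from rfl,
    abscissa, ordinate]
  ring

end FanCoordinates

/-! ### The elements of the fan triangulation -/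

/-- The vertices of the polygon, numbered by natural numbers. -/
def vtx (k : ℕ) : Fin (n + 3) := Fin.ofNat (n + 3) k

theorem vtx_val (a : Fin (n + 3)) : vtx a.val = a := by
  ext; simp [vtx]

theorem val_vtx {k : ℕ} (hk : k < n + 3) : (vtx k : Fin (n + 3)).val = k := by
  simp [vtx, Nat.mod_eq_of_lt hk]

theorem vtx_inj {k l : ℕ} (hk : k < n + 3) (hl : l < n + 3) :
    (vtx k : Fin (n + 3)) = vtx l ↔ k = l := by
  rw [Fin.ext_iff, val_vtx hk, val_vtx hl]

theorem vtx_ne {k l : ℕ} (hk : k < n + 3) (hl : l < n + 3) (h : k ≠ l) :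
    (vtx k : Fin (n + 3)) ≠ vtx l := by
  rwa [Ne, vtx_inj hk hl]

/-- `f → p_k`. -/
def edgeX (n k : ℕ) : Element n := edge (vtx 0) (vtx (k + 1))

/-- `p_k → f`. -/
def edgeG (n k : ℕ) : Element n := edge (vtx (k + 1)) (vtx 0)

/-- `p_k → p_{k+1}`. -/
def edgeUp (n k : ℕ) : Element n := edge (vtx (k + 1)) (vtx (k + 2))

/-- `p_k → p_{k-1}`. -/
def edgeDn (n k : ℕ) : Element n := edge (vtx (k + 1)) (vtx k)

/-- The face `f p_k p_{k+1}`. -/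
def faceF (n k : ℕ) : Element n := face (vtx 0) (vtx (k + 1)) (vtx (k + 2))

theorem fanVertex_eq : fanVertex n = vtx 0 := rfl

theorem p_castSucc (k : Fin (n + 1)) : (p k.castSucc : Fin (n + 3)) = vtx (k + 1) := by
  rw [← vtx_val (p k.castSucc)]; rfl

theorem p_succ (k : Fin (n + 1)) : (p k.succ : Fin (n + 3)) = vtx (k + 2) := by
  rw [← vtx_val (p k.succ)]; rfl

theorem fanTriangle_eq (k : Fin (n + 1)) :
    fanTriangle k = {vtx 0, vtx (k + 1), vtx (k + 2)} := by
  rw [fanTriangle, p_castSucc, p_succ]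
  rfl

theorem mem_fanTriangle {k : Fin (n + 1)} {x : Fin (n + 3)} :
    x ∈ fanTriangle k ↔ x.val = 0 ∨ x.val = k + 1 ∨ x.val = k + 2 := by
  rw [fanTriangle_eq]
  simp only [Finset.mem_insert, Finset.mem_singleton]
  rw [Fin.ext_iff, Fin.ext_iff, Fin.ext_iff, val_vtx (by omega), val_vtx (by omega),
    val_vtx (by omega)]

theorem fanTriangle_injective : Function.Injective (fanTriangle (n := n)) := by
  intro k l h
  have h1 : (vtx (k + 2) : Fin (n + 3)) ∈ fanTriangle l := by
    rw [← h, mem_fanTriangle, val_vtx (by omega)]; omega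
  have h2 : (vtx (l + 2) : Fin (n + 3)) ∈ fanTriangle k := by
    rw [h, mem_fanTriangle, val_vtx (by omega)]; omega
  rw [mem_fanTriangle, val_vtx (by omega)] at h1 h2
  ext
  omega

/-- The triangles of the fan triangulation. -/
def fanTriangles (n : ℕ) : Finset (Finset (Fin (n + 3))) := Finset.univ.image fanTriangle

theorem mem_initialElements_iff_isElem {e : Element n} :
    e ∈ initialElements n ↔ ∃ t ∈ fanTriangles n, IsElem t e := by
  simp only [initialElements, fanTriangles, Finset.mem_biUnion, Finset.mem_univ, true_and,
    Finset.mem_union, Finset.mem_image, Finset.mem_singleton, exists_exists_eq_and]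
  refine exists_congr fun k => ?_
  rcases e with ⟨x, y⟩ | t
  · simp [IsElem, and_assoc]
  · simp [IsElem]

theorem mem_initialElements {e : Element n} :
    e ∈ initialElements n ↔ ∃ k ≤ n, e = edgeX n k ∨ e = edgeX n (k + 1) ∨ e = edgeG n k ∨
      e = edgeG n (k + 1) ∨ e = edgeUp n k ∨ e = edgeDn n (k + 1) ∨ e = faceF n k := by
  rw [mem_initialElements_iff_isElem]
  simp only [fanTriangles, Finset.mem_image, Finset.mem_univ, true_and, exists_exists_eq_and]
  constructor
  · rintro ⟨k, hk⟩
    refine ⟨k, by omega, ?_⟩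
    rw [fanTriangle_eq] at hk
    rcases e with ⟨x, y⟩ | t
    · obtain ⟨hx, hy, hxy⟩ := hk
      simp only [Finset.mem_insert, Finset.mem_singleton] at hx hy
      simp only [edgeX, edgeG, edgeUp, edgeDn, faceF]
      rcases hx with rfl | rfl | rfl <;> rcases hy with rfl | rfl | rfl <;>
        first | exact absurd rfl hxy | simp
    · obtain rfl : t = _ := hk
      simp [faceF]
  · rintro ⟨k, hk, h⟩
    refine ⟨⟨k, by omega⟩, ?_⟩
    rw [fanTriangle_eq]
    have h1 : (vtx 0 : Fin (n + 3)) ≠ vtx (k + 1) := vtx_ne (by omega) (by omega) (by omega)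
    have h2 : (vtx 0 : Fin (n + 3)) ≠ vtx (k + 2) := vtx_ne (by omega) (by omega) (by omega)
    have h3 : (vtx (k + 1) : Fin (n + 3)) ≠ vtx (k + 2) := vtx_ne (by omega) (by omega) (by omega)
    rcases h with rfl | rfl | rfl | rfl | rfl | rfl | rfl <;>
      simp [IsElem, edgeX, edgeG, edgeUp, edgeDn, faceF, h1, h2, h3, h1.symm, h2.symm, h3.symm]

/-! ### The configuration with prescribed initial variables -/

open Classical in
/-- The initial variable on an element of the fan triangulation (`1` for all other elements). -/
noncomputable def elementX (e : Element n) : Ambient n :=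
  if h : e ∈ initialElements n then initialX ⟨e, h⟩ else 1

/-- The default value `1` makes every coordinate nonzero, so the lemmas on `FanCoordinates` apply
without bounds on the indices. -/
theorem elementX_ne_zero (e : Element n) : elementX e ≠ 0 := by
  unfold elementX
  split_ifs
  · exact (IsPositive.initialX _).ne_zero
  · exact one_ne_zero

/-- The initial variables as coordinates on configurations of flags. -/
noncomputable def fanCoordinates (n : ℕ) : FanCoordinates (Ambient n) where
  x k := elementX (edgeX n k)
  g k := elementX (edgeG n k)
  F k := elementX (faceF n k)
  up k := elementX (edgeUp n k)
  dn k := elementX (edgeDn n k)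

/-- The variables on all directed edges and faces. -/
noncomputable def variableOf (n : ℕ) : Element n → Ambient n :=
  flagVariable (fun a b => (fanCoordinates n).pairing a.val b.val)
    (fun a b c => (fanCoordinates n).det a.val b.val c.val)

theorem isFlagConfiguration_fanCoordinates (n : ℕ) :
    IsFlagConfiguration (fun a b : Fin (n + 3) => (fanCoordinates n).pairing a.val b.val)
    (fun a b c => (fanCoordinates n).det a.val b.val c.val) :=
  (fanCoordinates n).isFlagConfiguration _

theorem orient_fan {k : ℕ} (hk : k ≤ n) :
    orient (vtx 0 : Fin (n + 3)) (vtx (k + 1)) (vtx (k + 2)) = 1 := by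
  rw [orient, if_pos]
  left
  rw [Fin.lt_def, Fin.lt_def, val_vtx (by omega), val_vtx (by omega), val_vtx (by omega)]
  omega

theorem variableOf_eq_elementX {e : Element n} (he : e ∈ initialElements n) :
    variableOf n e = elementX e := by
  have hx : ∀ k, (fanCoordinates n).x k ≠ 0 := fun _ => elementX_ne_zero _
  have hg : ∀ k, (fanCoordinates n).g k ≠ 0 := fun _ => elementX_ne_zero _
  have hF : ∀ k, (fanCoordinates n).F k ≠ 0 := fun _ => elementX_ne_zero _
  obtain ⟨k, hk, h⟩ := mem_initialElements.1 he
  rcases h with rfl | rfl | rfl | rfl | rfl | rfl | rfl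
  · simp only [variableOf, flagVariable, edgeX]
    rw [val_vtx (by omega), val_vtx (by omega), FanCoordinates.pairing_zero_succ]
    rfl
  · simp only [variableOf, flagVariable, edgeX]
    rw [val_vtx (by omega), val_vtx (by omega), FanCoordinates.pairing_zero_succ]
    rfl
  · simp only [variableOf, flagVariable, edgeG]
    rw [val_vtx (by omega), val_vtx (by omega), FanCoordinates.pairing_succ_zero]
    rfl
  · simp only [variableOf, flagVariable, edgeG]
    rw [val_vtx (by omega), val_vtx (by omega), FanCoordinates.pairing_succ_zero]
    rfl
  · simp only [variableOf, flagVariable, edgeUp]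
    rw [val_vtx (by omega), val_vtx (by omega), FanCoordinates.pairing_succ_succ hx hF]
    rfl
  · simp only [variableOf, flagVariable, edgeDn]
    rw [val_vtx (by omega), val_vtx (by omega), FanCoordinates.pairing_succ_pred hx hg hF]
    rfl
  · rw [faceF, variableOf, flagVariable_face (isFlagConfiguration_fanCoordinates n), orient_fan hk,
      val_vtx (by omega), val_vtx (by omega), val_vtx (by omega), FanCoordinates.det_zero_succ hx]
    · simp [fanCoordinates, faceF]
    all_goals
      rw [Ne, vtx_inj (by omega) (by omega)]; omega

theorem not_crosses_fan {k l : Fin (n + 1)} {x y z w : Fin (n + 3)} (hx : x ∈ fanTriangle k)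
    (hy : y ∈ fanTriangle k) (hz : z ∈ fanTriangle l) (hw : w ∈ fanTriangle l) :
    ¬ Crosses x y z w := by
  rw [mem_fanTriangle] at hx hy hz hw
  -- A chord of a fan triangle contains the fan vertex `0` or has endpoints at distance at most one;
  -- two such chords cannot cross.
  have h1 : x.val = 0 ∨ y.val = 0 ∨ (x.val ≤ y.val + 1 ∧ y.val ≤ x.val + 1) := by omega
  have h2 : z.val = 0 ∨ w.val = 0 ∨ (z.val ≤ w.val + 1 ∧ w.val ≤ z.val + 1) := by omega
  clear hx hy hz hw
  unfold Crosses
  simp only [Fin.lt_def]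
  omega

/-! ### Seeds reached by flips from the fan -/

theorem isSeedOf_initialSeed (n : ℕ) (ε : ℤˣ) :
    IsSeedOf ε (variableOf n) (initialSeed n ε) (fanTriangles n) where
  card t ht := by
    obtain ⟨k, -, rfl⟩ := Finset.mem_image.1 ht
    rw [fanTriangle_eq, Finset.card_eq_three]
    refine ⟨_, _, _, ?_, ?_, ?_, rfl⟩ <;> rw [Ne, vtx_inj (by omega) (by omega)] <;> omega
  not_crosses t ht t' ht' x hx y hy z hz w hw := by
    obtain ⟨k, -, rfl⟩ := Finset.mem_image.1 ht
    obtain ⟨l, -, rfl⟩ := Finset.mem_image.1 ht'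
    exact not_crosses_fan hx hy hz hw
  inj := Subtype.val_injective
  label e := by
    rw [← mem_initialElements_iff_isElem]
    exact ⟨fun ⟨u, hu⟩ => hu ▸ u.2, fun h => ⟨⟨e, h⟩, rfl⟩⟩
  B u v := by
    rw [fanTriangles, Finset.sum_image (fun _ _ _ _ h => fanTriangle_injective h)]
    change (ε : ℤ) * _ = _
    congr 1
    refine Finset.sum_congr rfl fun k _ => ?_
    have h1 : (vtx 0 : Fin (n + 3)) ≠ vtx (k + 1) := vtx_ne (by omega) (by omega) (by omega)
    have h2 : (vtx 0 : Fin (n + 3)) ≠ vtx (k + 2) := vtx_ne (by omega) (by omega) (by omega)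
    have h3 : (vtx (k + 1) : Fin (n + 3)) ≠ vtx (k + 2) := vtx_ne (by omega) (by omega) (by omega)
    rw [fanTriangle_eq, triangleMatrix_eq h1 h2 h3, triMatrix, orient_fan (by omega), arrowMatrix,
      Units.val_one, one_mul, triArrows, ← p_castSucc, ← p_succ]
    rfl
  x u := by
    rw [show (initialSeed n ε).label u = u.1 from rfl, variableOf_eq_elementX u.2, elementX,
      dif_pos u.2]
    rfl
  pos u := IsPositive.initialX u

theorem IsSeedOf.of_reflTransGen {ε : ℤˣ} {s : Seed n}
    (hs : Relation.ReflTransGen Flip (initialSeed n ε) s) :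
    ∃ T, IsSeedOf ε (variableOf n) s T := by
  induction hs with
  | refl => exact ⟨_, isSeedOf_initialSeed n ε⟩
  | tail _ hf ih =>
    obtain ⟨T, hT⟩ := ih
    obtain ⟨a, b, c, d, u₁, u₂, u₃, u₄, hab, hac, had, hbc, hbd, hcd, h₁, h₂, h₃, h₄, rfl⟩ := hf
    have face_mem : ∀ {u t}, Seed.label _ u = Sum.inr t → t ∈ T := fun {u t} hu => by
      obtain ⟨t', ht', rfl⟩ := (hT.label _).1 ⟨u, hu⟩
      exact ht'
    have hX := hT.crosses hab hac had hbc hbd hcd (face_mem h₃) (face_mem h₄)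
    exact ⟨_, hT.flip
      (fun _ _ _ _ => flagVariable_exchange_edge (isFlagConfiguration_fanCoordinates n))
      (fun _ _ _ _ => flagVariable_exchange_face (isFlagConfiguration_fanCoordinates n))
      hX (face_mem h₃) (face_mem h₄) h₁ h₂ h₃ h₄⟩

/-- The flips of the first `k` diagonals. -/
theorem exists_seed_of_flips (ε : ℤˣ) (k : ℕ) (hk : k ≤ n) :
    ∃ s T, Relation.ReflTransGen Flip (initialSeed n ε) s ∧ IsSeedOf ε (variableOf n) s T ∧
      {vtx 0, vtx 1, vtx (k + 2)} ∈ T ∧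
      (∀ l, k < l → l ≤ n → {vtx 0, vtx (l + 1), vtx (l + 2)} ∈ T) ∧
      ∃ u, s.label u = edge (vtx 1) (vtx (k + 2)) := by
  induction k with
  | zero =>
    have key : ∀ l ≤ n, {vtx 0, vtx (l + 1), vtx (l + 2)} ∈ fanTriangles n := fun l hl =>
      Finset.mem_image.2 ⟨⟨l, by omega⟩, by simp, fanTriangle_eq _⟩
    refine ⟨_, _, .refl, isSeedOf_initialSeed n ε, key 0 (by omega), fun l _ hl => key l hl, ?_⟩
    exact ⟨⟨edgeUp n 0, mem_initialElements.2 ⟨0, by omega, by simp⟩⟩, rfl⟩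
  | succ k ih =>
    obtain ⟨s, T, hs, hT, h₁, h₂, -⟩ := ih (by omega)
    have ne : ∀ {i j : ℕ}, i < n + 3 → j < n + 3 → i ≠ j → (vtx i : Fin (n + 3)) ≠ vtx j :=
      fun hi hj h => by rwa [Ne, vtx_inj hi hj]
    have h₃ := h₂ (k + 1) (by omega) hk
    -- the quadrilateral `f`, `p₀`, `p_{k+1}`, `p_{k+2}`
    have hab := ne (i := 0) (j := 1) (by omega) (by omega) (by omega)
    have hac := ne (i := 0) (j := k + 2) (by omega) (by omega) (by omega)
    have had := ne (i := 0) (j := k + 3) (by omega) (by omega) (by omega)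
    have hbc := ne (i := 1) (j := k + 2) (by omega) (by omega) (by omega)
    have hbd := ne (i := 1) (j := k + 3) (by omega) (by omega) (by omega)
    have hcd := ne (i := k + 2) (j := k + 3) (by omega) (by omega) (by omega)
    obtain ⟨u₁, hu₁⟩ := (hT.label (edge (vtx 0) (vtx (k + 2)))).2
      ⟨_, h₁, by simp, by simp, hac⟩
    obtain ⟨u₂, hu₂⟩ := (hT.label (edge (vtx (k + 2)) (vtx 0))).2
      ⟨_, h₁, by simp, by simp, hac.symm⟩
    obtain ⟨u₃, hu₃⟩ := (hT.label (face (vtx 0) (vtx 1) (vtx (k + 2)))).2 ⟨_, h₁, rfl⟩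
    obtain ⟨u₄, hu₄⟩ := (hT.label (face (vtx 0) (vtx (k + 2)) (vtx (k + 3)))).2 ⟨_, h₃, rfl⟩
    have hX := hT.crosses hab hac had hbc hbd hcd h₁ h₃
    have hT' := hT.flip
      (fun _ _ _ _ => flagVariable_exchange_edge (isFlagConfiguration_fanCoordinates n))
      (fun _ _ _ _ => flagVariable_exchange_face (isFlagConfiguration_fanCoordinates n))
      hX h₁ h₃ hu₁ hu₂ hu₃ hu₄
    have hm : ({vtx 1, vtx (k + 3), vtx 0} : Finset (Fin (n + 3))) ∈
        flipTriangles T (vtx 0) (vtx 1) (vtx (k + 2)) (vtx (k + 3)) := by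
      simp [flipTriangles]
    refine ⟨_, _, hs.tail ⟨_, _, _, _, u₁, u₂, u₃, u₄, hab, hac, had, hbc, hbd, hcd, hu₁, hu₂,
      hu₃, hu₄, rfl⟩, hT', ?_, fun l hl hln => ?_, ?_⟩
    · rwa [triple_rotate] at hm
    · rw [flipTriangles, Finset.mem_insert, Finset.mem_insert, Finset.mem_erase, Finset.mem_erase]
      refine Or.inr (Or.inr ⟨fun h => ?_, fun h => ?_, h₂ l (by omega) hln⟩)
      · have : (vtx (l + 2) : Fin (n + 3)) ∈
            ({vtx 0, vtx (k + 2), vtx (k + 3)} : Finset (Fin (n + 3))) := h ▸ by simp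
        simp only [Finset.mem_insert, Finset.mem_singleton] at this
        rw [vtx_inj (by omega) (by omega), vtx_inj (by omega) (by omega),
          vtx_inj (by omega) (by omega)] at this
        omega
      · have : (vtx (l + 2) : Fin (n + 3)) ∈
            ({vtx 0, vtx 1, vtx (k + 2)} : Finset (Fin (n + 3))) := h ▸ by simp
        simp only [Finset.mem_insert, Finset.mem_singleton] at this
        rw [vtx_inj (by omega) (by omega), vtx_inj (by omega) (by omega),
          vtx_inj (by omega) (by omega)] at this
        omega
    · exact (hT'.label _).2 ⟨_, hm, by simp, by simp, hbd⟩

theorem p_zero : (p 0 : Fin (n + 3)) = vtx 1 := by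
  rw [← vtx_val (p 0)]; rfl

theorem p_last : (p (Fin.last (n + 1)) : Fin (n + 3)) = vtx (n + 2) := by
  rw [← vtx_val (p (Fin.last (n + 1)))]; rfl

/-- Uniqueness is the flip invariant; existence comes from flipping the diagonals of the fan one
after the other, starting next to `i`. -/
theorem isVariableOf_longestEdge_iff (ε : ℤˣ) (w : Ambient n) :
    IsVariableOf ε (longestEdge n) w ↔ w = variableOf n (longestEdge n) := by
  constructor
  · rintro ⟨s, hs, u, hu, rfl⟩
    obtain ⟨T, hT⟩ := IsSeedOf.of_reflTransGen hs
    rw [hT.x, hu]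
  · rintro rfl
    obtain ⟨s, T, hs, hT, -, -, u, hu⟩ := exists_seed_of_flips (n := n) ε n le_rfl
    refine ⟨s, hs, u, ?_, ?_⟩
    · rw [hu, longestEdge, p_zero, p_last]
    · rw [hT.x, hu, longestEdge, p_zero, p_last]

/-! ### Laurent monomials -/

theorem initialX_ne_zero (u : Node n) : initialX u ≠ 0 := (IsPositive.initialX u).ne_zero

theorem monomial_add (m m' : Node n → ℤ) : monomial (m + m') = monomial m * monomial m' := by
  simp only [monomial, Pi.add_apply, zpow_add₀ (initialX_ne_zero _), Finset.prod_mul_distrib]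

theorem monomial_sub (m m' : Node n → ℤ) : monomial (m - m') = monomial m / monomial m' := by
  simp only [monomial, Pi.sub_apply, zpow_sub₀ (initialX_ne_zero _), Finset.prod_div_distrib]

theorem monomial_of_nonneg {m : Node n → ℤ} (hm : ∀ u, 0 ≤ m u) :
    monomial m = algebraMap (MvPolynomial (Node n) ℚ) (Ambient n)
      (MvPolynomial.monomial (Finsupp.equivFunOnFinite.symm fun u => (m u).toNat) 1) := by
  rw [MvPolynomial.monomial_eq, Finsupp.prod_fintype _ _ (fun _ => pow_zero _), map_one, one_mul,
    map_prod, monomial]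
  refine Finset.prod_congr rfl fun u _ => ?_
  rw [map_pow, Finsupp.equivFunOnFinite_symm_apply_apply, initialX, ← zpow_natCast,
    Int.toNat_of_nonneg (hm u)]

/-- Multiplication by a large monomial turns the relation into one between distinct monomials of a
polynomial ring, where coefficients can be compared. -/
theorem eq_zero_of_laurent_sum_eq_zero {d : (Node n → ℤ) →₀ ℤ}
    (h : (d.sum fun m a => (a : Ambient n) * monomial m) = 0) : d = 0 := by
  classical
  -- A sum of absolute values dominates every exponent that occurs, so all shifted exponents are
  -- nonnegative.
  set N : Node n → ℤ := fun u => ∑ m ∈ d.support, |m u| with hN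
  have hN0 : ∀ m ∈ d.support, ∀ u, 0 ≤ (m + N) u := fun m hm u => by
    have : |m u| ≤ N u := Finset.single_le_sum (f := fun m : Node n → ℤ => |m u|)
      (fun _ _ => abs_nonneg _) hm
    have := neg_abs_le (m u)
    simp only [Pi.add_apply]
    linarith
  set s : (Node n → ℤ) → (Node n →₀ ℕ) := fun m =>
    Finsupp.equivFunOnFinite.symm fun u => ((m + N) u).toNat with hs
  have hP : ∑ m ∈ d.support, MvPolynomial.monomial (s m) (d m : ℚ) = 0 := by
    apply FaithfulSMul.algebraMap_injective (MvPolynomial (Node n) ℚ) (Ambient n)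
    rw [map_zero, map_sum, ← zero_mul (monomial N), ← h, Finsupp.sum, Finset.sum_mul]
    refine Finset.sum_congr rfl fun m hm => ?_
    rw [mul_assoc, ← monomial_add, monomial_of_nonneg (hN0 m hm), ← map_intCast
      (algebraMap (MvPolynomial (Node n) ℚ) (Ambient n)), ← map_mul]
    congr 1
    rw [← map_intCast (MvPolynomial.C : ℚ →+* MvPolynomial (Node n) ℚ), MvPolynomial.C_mul_monomial,
      mul_one]
  ext m
  by_contra hm
  have hm' : m ∈ d.support := Finsupp.mem_support_iff.2 hm
  have := congrArg (MvPolynomial.coeff (s m)) hP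
  rw [MvPolynomial.coeff_sum, Finset.sum_eq_single_of_mem m hm', MvPolynomial.coeff_monomial,
    if_pos rfl, MvPolynomial.coeff_zero] at this
  · exact hm (by exact_mod_cast this)
  · intro m' hm'' hne
    rw [MvPolynomial.coeff_monomial, if_neg]
    intro hss
    apply hne
    ext u
    have h1 := DFunLike.congr_fun hss u
    simp only [hs, Finsupp.equivFunOnFinite_symm_apply_apply] at h1
    have h2 := hN0 m hm' u
    have h3 := hN0 m' hm'' u
    simp only [Pi.add_apply] at h1 h2 h3
    omega

theorem IsLaurentExpansion.unique {z : Ambient n} {c c' : (Node n → ℤ) →₀ ℤ}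
    (h : IsLaurentExpansion z c) (h' : IsLaurentExpansion z c') : c = c' := by
  rw [← sub_eq_zero]
  apply eq_zero_of_laurent_sum_eq_zero
  rw [Finsupp.sum_sub_index (fun _ _ _ => by push_cast; ring), ← h, ← h', sub_self]

/-! ### Exponents of the terms -/

/-- The exponents of the initial variable on `e`. -/
def unitExp (e : Element n) (v : Node n) : ℤ := if v.1 = e then 1 else 0

theorem monomial_unitExp (e : Element n) : monomial (unitExp e) = elementX e := by
  unfold monomial elementX unitExp
  split_ifs with he
  · rw [Finset.prod_eq_single_of_mem ⟨e, he⟩ (Finset.mem_univ _)]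
    · simp
    · intro u _ hu
      rw [if_neg fun h => hu (Subtype.ext h), zpow_zero]
  · refine Finset.prod_eq_one fun u _ => ?_
    rw [if_neg (by rintro rfl; exact he u.2), zpow_zero]

/-- The exponents of the widths. -/
def widthExp (n k : ℕ) : Node n → ℤ :=
  unitExp (faceF n k) - unitExp (edgeX n k) - unitExp (edgeX n (k + 1))

/-- The exponents of `FanCoordinates.term`. -/
def slopeExp (n m : ℕ) : Node n → ℤ :=
  if m % 2 = 0 then
    unitExp (edgeG n 0) + unitExp (edgeX n (m / 2)) + unitExp (edgeUp n (m / 2)) -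
      unitExp (edgeG n (m / 2)) - unitExp (faceF n (m / 2))
  else
    unitExp (edgeG n 0) + unitExp (edgeX n (m / 2 + 1)) + unitExp (edgeDn n (m / 2 + 1)) -
      unitExp (edgeG n (m / 2 + 1)) - unitExp (faceF n (m / 2))

/-- The exponents of the terms of the expansion of the longest edge. -/
def termExp (n k m : ℕ) : Node n → ℤ :=
  unitExp (edgeX n (n + 1)) + widthExp n k + slopeExp n m

theorem monomial_termExp (k m : ℕ) :
    monomial (termExp n k m) =
      (fanCoordinates n).x (n + 1) * (fanCoordinates n).width k * (fanCoordinates n).term m := by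
  have h1 : monomial (widthExp n k) = (fanCoordinates n).width k := by
    simp only [widthExp, monomial_sub, monomial_unitExp, FanCoordinates.width, fanCoordinates,
      div_div]
  have h2 : monomial (slopeExp n m) = (fanCoordinates n).term m := by
    unfold slopeExp FanCoordinates.term
    split_ifs <;>
      simp only [monomial_sub, monomial_add, monomial_unitExp, fanCoordinates, div_div]
  rw [termExp, monomial_add, monomial_add, h1, h2, monomial_unitExp]
  rfl

theorem variableOf_longestEdge (n : ℕ) :
    variableOf n (longestEdge n) =
      ∑ k ∈ Finset.range (n + 1), ∑ m ∈ Finset.range (2 * k + 1), monomial (termExp n k m) := by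
  simp only [monomial_termExp]
  rw [← FanCoordinates.pairing_one (fun _ => elementX_ne_zero _), longestEdge, p_zero, p_last]
  simp only [variableOf, flagVariable]
  rw [val_vtx (by omega), val_vtx (by omega)]

/-! ### The exponents of the `ŷ` -/

/-- The exponents of `ŷ_u`, if the vertices are in counterclockwise order. -/
def yExp (u v : Node n) : ℤ := ∑ k : Fin (n + 1), arrowMatrix (triangleArrows k) v.1 u.1

/-- Since `ε² = 1`, the sign in the definition of the order cancels the sign of the quiver, and both
orientations give the same poset. -/
theorem units_mul_yHat (ε : ℤˣ) (u v : Node n) : ε * yHat ε u v = yExp u v := by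
  rw [yHat, initialB, ← mul_assoc, ← Units.val_mul, Int.units_mul_self, Units.val_one, one_mul]
  rfl

section Triangle

variable {a b c : Fin (n + 3)} (hab : a ≠ b) (hac : a ≠ c) (hbc : b ≠ c) (v : Node n)
include hab hac hbc

theorem arrowMatrix_fst :
    arrowMatrix (triArrows a b c) v.1 (edge a b) =
      unitExp (face a b c) v - unitExp (edge a c) v := by
  rw [triArrows_eq]
  simp [arrowMatrix, List.count_cons, unitExp, hab, hac, hbc, hab.symm, hac.symm, hbc.symm,
    eq_comm (b := v.1)]

theorem arrowMatrix_snd :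
    arrowMatrix (triArrows a b c) v.1 (edge a c) =
      unitExp (edge a b) v - unitExp (face a b c) v := by
  rw [triArrows_eq]
  simp [arrowMatrix, List.count_cons, unitExp, hab, hac, hbc, hab.symm, hac.symm, hbc.symm,
    eq_comm (b := v.1)]

end Triangle

theorem arrowMatrix_face (a b c : Fin (n + 3)) (v : Node n) :
    arrowMatrix (triArrows a b c) v.1 (face a b c) =
      unitExp (edge a c) v + unitExp (edge b a) v + unitExp (edge c b) v -
        (unitExp (edge a b) v + unitExp (edge b c) v + unitExp (edge c a) v) := by
  rw [triArrows_eq]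
  simp [arrowMatrix, List.count_cons, unitExp, eq_comm (b := v.1)]
  ring

theorem triangleArrows_eq (k : Fin (n + 1)) :
    triangleArrows k = triArrows (vtx 0) (vtx (k + 1)) (vtx (k + 2)) := by
  rw [← p_castSucc, ← p_succ]
  rfl

theorem arrowMatrix_eq_zero {k : Fin (n + 1)} {e : Element n} (v : Element n)
    (h : ¬ IsElem (fanTriangle k) e) : arrowMatrix (triangleArrows k) v e = 0 := by
  rw [fanTriangle_eq] at h
  rw [triangleArrows_eq, arrowMatrix, List.count_eq_zero_of_not_mem,
    List.count_eq_zero_of_not_mem, sub_self]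
  · exact fun h' => h (isElem_of_mem_triArrows (vtx_ne (by omega) (by omega) (by omega))
      (vtx_ne (by omega) (by omega) (by omega)) (vtx_ne (by omega) (by omega) (by omega)) h').1
  · exact fun h' => h (isElem_of_mem_triArrows (vtx_ne (by omega) (by omega) (by omega))
      (vtx_ne (by omega) (by omega) (by omega)) (vtx_ne (by omega) (by omega) (by omega)) h').2

/-- Only the two triangles at the diagonal contribute, each with one incoming and one outgoing
arrow. -/
theorem yExp_edgeX {l : ℕ} (hl : l < n) {u : Node n} (hu : u.1 = edgeX n (l + 1)) :
    yExp u = unitExp (edgeX n l) - unitExp (faceF n l) +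
      (unitExp (faceF n (l + 1)) - unitExp (edgeX n (l + 2))) := by
  ext v
  rw [yExp, hu, Fintype.sum_eq_add ⟨l, by omega⟩ ⟨l + 1, by omega⟩
    (fun h => absurd (Fin.ext_iff.1 h) (Nat.succ_ne_self l).symm),
    triangleArrows_eq, triangleArrows_eq]
  · dsimp only [edgeX]
    rw [arrowMatrix_snd, arrowMatrix_fst]
    · rfl
    all_goals exact vtx_ne (by omega) (by omega) (by omega)
  · rintro k ⟨hk, hk'⟩
    apply arrowMatrix_eq_zero
    rintro ⟨-, h, -⟩
    rw [mem_fanTriangle, val_vtx (by omega)] at h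
    simp only [Ne, Fin.ext_iff] at hk hk'
    omega

theorem yExp_edgeG {l : ℕ} (hl : l < n) {u : Node n} (hu : u.1 = edgeG n (l + 1)) :
    yExp u = unitExp (faceF n l) - unitExp (edgeDn n (l + 1)) +
      (unitExp (edgeUp n (l + 1)) - unitExp (faceF n (l + 1))) := by
  ext v
  rw [yExp, hu, Fintype.sum_eq_add ⟨l, by omega⟩ ⟨l + 1, by omega⟩
    (fun h => absurd (Fin.ext_iff.1 h) (Nat.succ_ne_self l).symm),
    triangleArrows_eq, triangleArrows_eq]
  · dsimp only [edgeG]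
    -- Both triangles are rotated so that `p_{l+1}` becomes the first vertex and the corner lemmas
    -- apply.
    rw [← arrowMatrix_rotate (vtx 0), ← arrowMatrix_rotate (vtx (l + 1)),
      ← arrowMatrix_rotate (vtx 0) (vtx (l + 1 + 1)), arrowMatrix_snd, arrowMatrix_fst,
      face_rotate (vtx (l + 1)) (vtx (l + 2)) (vtx 0), face_rotate (vtx 0) (vtx (l + 1)),
      face_rotate (vtx 0) (vtx (l + 1 + 1))]
    · rfl
    all_goals exact vtx_ne (by omega) (by omega) (by omega)
  · rintro k ⟨hk, hk'⟩
    apply arrowMatrix_eq_zero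
    rintro ⟨h, -, -⟩
    rw [mem_fanTriangle, val_vtx (by omega)] at h
    simp only [Ne, Fin.ext_iff] at hk hk'
    omega

theorem yExp_faceF {l : ℕ} (hl : l ≤ n) {u : Node n} (hu : u.1 = faceF n l) :
    yExp u = unitExp (edgeX n (l + 1)) + unitExp (edgeG n l) + unitExp (edgeDn n (l + 1)) -
      (unitExp (edgeX n l) + unitExp (edgeUp n l) + unitExp (edgeG n (l + 1))) := by
  ext v
  rw [yExp, hu, Fintype.sum_eq_single ⟨l, by omega⟩, triangleArrows_eq]
  · dsimp only [faceF]
    rw [arrowMatrix_face]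
    rfl
  · intro k hk
    apply arrowMatrix_eq_zero
    intro h
    have h' : fanTriangle ⟨l, by omega⟩ = fanTriangle k := by
      rw [fanTriangle_eq]
      exact h
    exact hk (fanTriangle_injective h').symm

theorem vtx_add_one (k : ℕ) : (vtx k : Fin (n + 3)) + 1 = vtx (k + 1) := by
  ext
  simp [vtx, Fin.val_add]

theorem vtx_self : (vtx (n + 3) : Fin (n + 3)) = vtx 0 := by
  ext
  simp [vtx]

/-- The two extreme spokes `f p_0` and `f p_{n+1}` are boundary edges, the latter by wrap-around;
this leaves the `n` diagonals and `n + 1` faces. -/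
theorem exists_of_not_isFrozen {u : Node n} (hu : ¬ IsFrozen u.1) :
    (∃ l < n, u.1 = edgeX n (l + 1)) ∨ (∃ l < n, u.1 = edgeG n (l + 1)) ∨
      ∃ l ≤ n, u.1 = faceF n l := by
  have h0 : (vtx 0 : Fin (n + 3)) + 1 = vtx 1 := vtx_add_one 0
  have hlast : (vtx (n + 2) : Fin (n + 3)) + 1 = vtx 0 := by rw [vtx_add_one, vtx_self]
  obtain ⟨k, hk, h⟩ := mem_initialElements.1 u.2
  have caseX : ∀ k ≤ n + 1, u.1 = edgeX n k → ∃ l < n, u.1 = edgeX n (l + 1) := by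
    intro k hk h
    rw [h] at hu
    rcases k with _ | l
    · exact absurd (Or.inl h0.symm) hu
    · rcases Nat.lt_or_ge l n with hl | hl
      · exact ⟨l, hl, h⟩
      · obtain rfl : l = n := by omega
        exact absurd (Or.inr hlast.symm) hu
  have caseG : ∀ k ≤ n + 1, u.1 = edgeG n k → ∃ l < n, u.1 = edgeG n (l + 1) := by
    intro k hk h
    rw [h] at hu
    rcases k with _ | l
    · exact absurd (Or.inr h0.symm) hu
    · rcases Nat.lt_or_ge l n with hl | hl
      · exact ⟨l, hl, h⟩
      · obtain rfl : l = n := by omega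
        exact absurd (Or.inl hlast.symm) hu
  rcases h with h | h | h | h | h | h | h
  · exact Or.inl (caseX _ (by omega) h)
  · exact Or.inl (caseX _ (by omega) h)
  · exact Or.inr (Or.inl (caseG _ (by omega) h))
  · exact Or.inr (Or.inl (caseG _ (by omega) h))
  · rw [h] at hu
    exact absurd (Or.inl (vtx_add_one _).symm) hu
  · rw [h] at hu
    exact absurd (Or.inr (vtx_add_one _).symm) hu
  · exact Or.inr (Or.inr ⟨k, hk, h⟩)

theorem not_isFrozen_edgeX {l : ℕ} (hl : l < n) : ¬ IsFrozen (edgeX n (l + 1)) := by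
  rintro (h | h) <;> rw [vtx_add_one] at h
  · exact vtx_ne (by omega) (by omega) (by omega) h
  · exact vtx_ne (by omega) (by omega) (by omega) h

theorem not_isFrozen_edgeG {l : ℕ} (hl : l < n) : ¬ IsFrozen (edgeG n (l + 1)) := by
  rintro (h | h) <;> rw [vtx_add_one] at h
  · exact vtx_ne (by omega) (by omega) (by omega) h
  · exact vtx_ne (by omega) (by omega) (by omega) h

/-! ### Weights -/

/-- The weighted degree of exponents. -/
def weight (w : Element n → ℤ) (m : Node n → ℤ) : ℤ := ∑ v, w v.1 * m v

theorem weight_add (w : Element n → ℤ) (m m' : Node n → ℤ) :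
    weight w (m + m') = weight w m + weight w m' := by
  simp [weight, mul_add, Finset.sum_add_distrib]

theorem weight_sub (w : Element n → ℤ) (m m' : Node n → ℤ) :
    weight w (m - m') = weight w m - weight w m' := by
  simp [weight, mul_sub, Finset.sum_sub_distrib]

theorem weight_unitExp (w : Element n → ℤ) {e : Element n} (he : e ∈ initialElements n) :
    weight w (unitExp e) = w e := by
  rw [weight, Finset.sum_eq_single_of_mem ⟨e, he⟩ (Finset.mem_univ _)]
  · simp [unitExp]
  · intro v _ hv
    rw [unitExp, if_neg fun h => hv (Subtype.ext h), mul_zero]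

theorem edgeX_mem {k : ℕ} (hk : k ≤ n + 1) : edgeX n k ∈ initialElements n := by
  rcases k with _ | k
  · exact mem_initialElements.2 ⟨0, by omega, by simp⟩
  · exact mem_initialElements.2 ⟨k, by omega, by simp⟩

theorem edgeG_mem {k : ℕ} (hk : k ≤ n + 1) : edgeG n k ∈ initialElements n := by
  rcases k with _ | k
  · exact mem_initialElements.2 ⟨0, by omega, by simp⟩
  · exact mem_initialElements.2 ⟨k, by omega, by simp⟩

theorem edgeUp_mem {k : ℕ} (hk : k ≤ n) : edgeUp n k ∈ initialElements n :=
  mem_initialElements.2 ⟨k, hk, by simp⟩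

theorem edgeDn_mem {k : ℕ} (hk : k ≤ n) : edgeDn n (k + 1) ∈ initialElements n :=
  mem_initialElements.2 ⟨k, hk, by simp⟩

theorem faceF_mem {k : ℕ} (hk : k ≤ n) : faceF n k ∈ initialElements n :=
  mem_initialElements.2 ⟨k, hk, by simp⟩

/-- The weights for which the degree of `ŷ_u` is `2` if `u` is `f → p_k`, and otherwise `0`. -/
def weightFst : Element n → ℤ
  | Sum.inl (a, b) => if a = vtx 0 ∨ b = vtx 0 then -((a.val : ℤ) + b.val) else 0
  | Sum.inr _ => 0

/-- The weights for which the degree of `ŷ_u` is `0` if `u` is `f → p_k`, and otherwise `1`. -/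
def weightSnd : Element n → ℤ
  | Sum.inl (a, b) =>
    if a = vtx 0 then 0 else if b = vtx 0 then -(2 * (a.val : ℤ)) else if b < a then -1 else 0
  | Sum.inr _ => 0

theorem weightFst_edgeX {k : ℕ} (hk : k ≤ n + 1) : weightFst (edgeX n k) = -(k + 1) := by
  simp [weightFst, edgeX, val_vtx (n := n) (k := 0) (by omega),
    val_vtx (n := n) (k := k + 1) (by omega)]

theorem weightFst_edgeG {k : ℕ} (hk : k ≤ n + 1) : weightFst (edgeG n k) = -(k + 1) := by
  simp [weightFst, edgeG, val_vtx (n := n) (k := 0) (by omega),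
    val_vtx (n := n) (k := k + 1) (by omega)]

theorem weightFst_edgeUp {k : ℕ} (hk : k ≤ n) : weightFst (edgeUp n k) = 0 := by
  simp [weightFst, edgeUp, vtx_ne (n := n) (k := k + 1) (l := 0) (by omega) (by omega) (by omega),
    vtx_ne (n := n) (k := k + 2) (l := 0) (by omega) (by omega) (by omega)]

theorem weightFst_edgeDn {k : ℕ} (hk : k ≤ n) : weightFst (edgeDn n (k + 1)) = 0 := by
  simp [weightFst, edgeDn, vtx_ne (n := n) (k := k + 1) (l := 0) (by omega) (by omega) (by omega),
    vtx_ne (n := n) (k := k + 2) (l := 0) (by omega) (by omega) (by omega)]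

theorem weightFst_faceF (k : ℕ) : weightFst (faceF n k) = 0 := rfl

theorem weightSnd_edgeX (k : ℕ) : weightSnd (edgeX n k) = 0 := by
  simp [weightSnd, edgeX]

theorem weightSnd_edgeG {k : ℕ} (hk : k ≤ n + 1) : weightSnd (edgeG n k) = -(2 * (k + 1)) := by
  simp [weightSnd, edgeG, val_vtx (n := n) (k := k + 1) (by omega),
    vtx_ne (n := n) (k := k + 1) (l := 0) (by omega) (by omega) (by omega)]

theorem weightSnd_edgeUp {k : ℕ} (hk : k ≤ n) : weightSnd (edgeUp n k) = 0 := by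
  simp [weightSnd, edgeUp, vtx_ne (n := n) (k := k + 1) (l := 0) (by omega) (by omega) (by omega),
    vtx_ne (n := n) (k := k + 2) (l := 0) (by omega) (by omega) (by omega), Fin.lt_def,
    val_vtx (n := n) (k := k + 1) (by omega), val_vtx (n := n) (k := k + 2) (by omega)]

theorem weightSnd_edgeDn {k : ℕ} (hk : k ≤ n) : weightSnd (edgeDn n (k + 1)) = -1 := by
  simp [weightSnd, edgeDn, vtx_ne (n := n) (k := k + 1) (l := 0) (by omega) (by omega) (by omega),
    vtx_ne (n := n) (k := k + 2) (l := 0) (by omega) (by omega) (by omega), Fin.lt_def,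
    val_vtx (n := n) (k := k + 1) (by omega), val_vtx (n := n) (k := k + 2) (by omega)]

theorem weightSnd_faceF (k : ℕ) : weightSnd (faceF n k) = 0 := rfl

/-- The two weights are, up to an affine change, the coordinates `(k, m)` of a term. -/
theorem weight_termExp {k m : ℕ} (hk : k ≤ n) (hm : m ≤ 2 * k) :
    weight weightFst (termExp n k m) = 2 * k - n ∧ weight weightSnd (termExp n k m) = m := by
  rw [termExp, widthExp, slopeExp]
  rcases Nat.even_or_odd' m with ⟨l, rfl | rfl⟩
  · have h1 : 2 * l % 2 = 0 := by omega
    have h2 : 2 * l / 2 = l := by omega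
    have hl : l ≤ n := by omega
    simp only [h1, h2, if_true, weight_add, weight_sub]
    simp only [weight_unitExp _ (edgeX_mem (n := n) le_rfl),
      weight_unitExp _ (edgeX_mem (n := n) (k := k) (by omega)),
      weight_unitExp _ (edgeX_mem (n := n) (k := k + 1) (by omega)),
      weight_unitExp _ (edgeX_mem (n := n) (k := l) (by omega)),
      weight_unitExp _ (edgeG_mem (n := n) (k := 0) (by omega)),
      weight_unitExp _ (edgeG_mem (n := n) (k := l) (by omega)),
      weight_unitExp _ (edgeUp_mem hl), weight_unitExp _ (faceF_mem hk),
      weight_unitExp _ (faceF_mem hl)]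
    rw [weightFst_edgeX le_rfl, weightFst_edgeX (by omega), weightFst_edgeX (by omega),
      weightFst_edgeX (by omega), weightFst_edgeG (by omega), weightFst_edgeG (by omega),
      weightFst_edgeUp hl, weightFst_faceF, weightFst_faceF, weightSnd_edgeX, weightSnd_edgeX,
      weightSnd_edgeX, weightSnd_edgeX, weightSnd_edgeG (by omega), weightSnd_edgeG (by omega),
      weightSnd_edgeUp hl, weightSnd_faceF, weightSnd_faceF]
    push_cast
    constructor <;> ring
  · have h1 : (2 * l + 1) % 2 = 1 := by omega
    have h2 : (2 * l + 1) / 2 = l := by omega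
    have hl : l ≤ n := by omega
    simp only [h1, h2, one_ne_zero, if_false, weight_add, weight_sub]
    simp only [weight_unitExp _ (edgeX_mem (n := n) le_rfl),
      weight_unitExp _ (edgeX_mem (n := n) (k := k) (by omega)),
      weight_unitExp _ (edgeX_mem (n := n) (k := k + 1) (by omega)),
      weight_unitExp _ (edgeX_mem (n := n) (k := l + 1) (by omega)),
      weight_unitExp _ (edgeG_mem (n := n) (k := 0) (by omega)),
      weight_unitExp _ (edgeG_mem (n := n) (k := l + 1) (by omega)),
      weight_unitExp _ (edgeDn_mem hl), weight_unitExp _ (faceF_mem hk),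
      weight_unitExp _ (faceF_mem hl)]
    rw [weightFst_edgeX le_rfl, weightFst_edgeX (by omega), weightFst_edgeX (by omega),
      weightFst_edgeX (by omega), weightFst_edgeG (by omega), weightFst_edgeG (by omega),
      weightFst_edgeDn hl, weightFst_faceF, weightFst_faceF, weightSnd_edgeX, weightSnd_edgeX,
      weightSnd_edgeX, weightSnd_edgeX, weightSnd_edgeG (by omega), weightSnd_edgeG (by omega),
      weightSnd_edgeDn hl, weightSnd_faceF, weightSnd_faceF]
    push_cast
    constructor <;> ring

/-- In the coordinates given by the weights, every mutable `ŷ` is a unit step to the right or a unit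
step up. This excludes all further relations between terms. -/
theorem weight_yExp {u : Node n} (hu : ¬ IsFrozen u.1) :
    (weight weightFst (yExp u) = 2 ∧ weight weightSnd (yExp u) = 0) ∨
      (weight weightFst (yExp u) = 0 ∧ weight weightSnd (yExp u) = 1) := by
  rcases exists_of_not_isFrozen hu with ⟨l, hl, h⟩ | ⟨l, hl, h⟩ | ⟨l, hl, h⟩
  · left
    rw [yExp_edgeX hl h]
    simp only [weight_add, weight_sub]
    simp only [weight_unitExp _ (edgeX_mem (n := n) (k := l) (by omega)),
      weight_unitExp _ (edgeX_mem (n := n) (k := l + 2) (by omega)),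
      weight_unitExp _ (faceF_mem (n := n) (k := l) (by omega)),
      weight_unitExp _ (faceF_mem (n := n) (k := l + 1) (by omega))]
    rw [weightFst_edgeX (by omega), weightFst_edgeX (by omega), weightFst_faceF, weightFst_faceF,
      weightSnd_edgeX, weightSnd_edgeX, weightSnd_faceF, weightSnd_faceF]
    push_cast
    exact ⟨by ring, trivial⟩
  · right
    rw [yExp_edgeG hl h]
    simp only [weight_add, weight_sub]
    simp only [weight_unitExp _ (edgeDn_mem (n := n) (k := l) (by omega)),
      weight_unitExp _ (edgeUp_mem (n := n) (k := l + 1) (by omega)),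
      weight_unitExp _ (faceF_mem (n := n) (k := l) (by omega)),
      weight_unitExp _ (faceF_mem (n := n) (k := l + 1) (by omega))]
    rw [weightFst_edgeDn (by omega), weightFst_edgeUp (by omega), weightFst_faceF, weightFst_faceF,
      weightSnd_edgeDn (by omega), weightSnd_edgeUp (by omega), weightSnd_faceF, weightSnd_faceF]
    constructor <;> norm_num
  · right
    rw [yExp_faceF hl h]
    simp only [weight_add, weight_sub]
    simp only [weight_unitExp _ (edgeX_mem (n := n) (k := l) (by omega)),
      weight_unitExp _ (edgeX_mem (n := n) (k := l + 1) (by omega)),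
      weight_unitExp _ (edgeG_mem (n := n) (k := l) (by omega)),
      weight_unitExp _ (edgeG_mem (n := n) (k := l + 1) (by omega)),
      weight_unitExp _ (edgeDn_mem hl), weight_unitExp _ (edgeUp_mem hl)]
    rw [weightFst_edgeX (by omega), weightFst_edgeX (by omega), weightFst_edgeG (by omega),
      weightFst_edgeG (by omega), weightFst_edgeDn hl, weightFst_edgeUp hl, weightSnd_edgeX,
      weightSnd_edgeX, weightSnd_edgeG (by omega), weightSnd_edgeG (by omega), weightSnd_edgeDn hl,
      weightSnd_edgeUp hl]
    push_cast
    constructor <;> ring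

/-! ### Neighbouring terms -/

/-- The quotient of consecutive widths is the `ŷ` of the edge `f → p_{k+1}` between the two
triangles. -/
theorem termExp_succ_left {k : ℕ} (hk : k < n) (m : ℕ) :
    ∃ u : Node n, ¬ IsFrozen u.1 ∧ termExp n (k + 1) m = termExp n k m + yExp u := by
  refine ⟨⟨edgeX n (k + 1), edgeX_mem (by omega)⟩, not_isFrozen_edgeX hk, ?_⟩
  rw [yExp_edgeX hk rfl, termExp, termExp, widthExp, widthExp]
  abel

/-- From `m = 2l` the step is the `ŷ` of the face `f p_l p_{l+1}`; from `m = 2l + 1` it is the `ŷ`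
of the edge `p_{l+1} → f`. -/
theorem termExp_succ_right {k m : ℕ} (hk : k ≤ n) (hm : m + 1 ≤ 2 * k) :
    ∃ u : Node n, ¬ IsFrozen u.1 ∧ termExp n k (m + 1) = termExp n k m + yExp u := by
  rcases Nat.even_or_odd' m with ⟨l, rfl | rfl⟩
  · have h1 : 2 * l % 2 = 0 := by omega
    have h2 : 2 * l / 2 = l := by omega
    have h3 : (2 * l + 1) % 2 = 1 := by omega
    have h4 : (2 * l + 1) / 2 = l := by omega
    refine ⟨⟨faceF n l, faceF_mem (by omega)⟩, fun h => h, ?_⟩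
    rw [yExp_faceF (by omega) rfl, termExp, termExp, slopeExp, slopeExp]
    simp only [h1, h2, h3, h4, one_ne_zero, if_true, if_false]
    abel
  · have h1 : (2 * l + 1) % 2 = 1 := by omega
    have h2 : (2 * l + 1) / 2 = l := by omega
    have h3 : (2 * l + 1 + 1) % 2 = 0 := by omega
    have h4 : (2 * l + 1 + 1) / 2 = l + 1 := by omega
    refine ⟨⟨edgeG n (l + 1), edgeG_mem (by omega)⟩, not_isFrozen_edgeG (by omega), ?_⟩
    rw [yExp_edgeG (by omega) rfl, termExp, termExp, slopeExp, slopeExp]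
    simp only [h1, h2, h3, h4, one_ne_zero, if_true, if_false]
    abel

/-- In `x_{n+1} · F_0 / (x_0 x_1) · x_0 up_0 / F_0` everything cancels except `x_{n+1} up_0 / x_1`.
-/
theorem termExp_zero_zero (n : ℕ) :
    termExp n 0 0 = threeEdgePath (p 0) (p 1) (fanVertex n) (p (Fin.last (n + 1))) := by
  have h1 : (p 1 : Fin (n + 3)) = vtx 2 := by
    rw [← vtx_val (p 1)]
    rfl
  ext v
  simp only [termExp, widthExp, slopeExp, threeEdgePath, p_zero, p_last, h1, fanVertex_eq,
    Nat.zero_mod, if_true, Nat.zero_div, Pi.add_apply, Pi.sub_apply]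
  simp only [unitExp, edgeX, edgeUp]
  ring_nf

/-- In `x_{n+1} · F_n / (x_n x_{n+1}) · g_0 x_n up_n / (g_n F_n)` what remains is `g_0 up_n / g_n`.
-/
theorem termExp_last (n : ℕ) :
    termExp n n (2 * n) = threeEdgePath (p 0) (fanVertex n) (p (Fin.last n).castSucc)
      (p (Fin.last (n + 1))) := by
  have h1 : 2 * n % 2 = 0 := by omega
  have h2 : 2 * n / 2 = n := by omega
  ext v
  simp only [termExp, widthExp, slopeExp, threeEdgePath, p_zero, p_last, p_castSucc, fanVertex_eq,
    h1, h2, if_true, Pi.add_apply, Pi.sub_apply]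
  simp only [unitExp, edgeX, edgeUp, edgeG, Fin.val_last]
  ring_nf

/-! ### The region `L_γ` -/

theorem abbWord_succ (n : ℕ) :
    abbWord (n + 1) = Letter.a :: Letter.b :: Letter.b :: abbWord n := by
  simp [abbWord, List.replicate_succ]

/-- Each block `ab²` moves one column to the right and climbs two steps in it. The starting point is
arbitrary for the sake of the induction. -/
theorem mem_scanl_abbWord (n : ℕ) (q r : ℤ × ℤ) :
    r ∈ (abbWord n).scanl (fun q l => q + l.step) q ↔
      r = q ∨ ∃ k : ℕ, k < n ∧ r.1 = q.1 + k + 1 ∧ q.2 + 2 * k ≤ r.2 ∧ r.2 ≤ q.2 + 2 * k + 2 := by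
  induction n generalizing q with
  | zero => simp [abbWord]
  | succ n ih =>
    rw [abbWord_succ]
    simp only [List.scanl_cons, List.mem_cons, ih]
    obtain ⟨q₁, q₂⟩ := q
    obtain ⟨r₁, r₂⟩ := r
    simp only [Letter.step, Prod.mk_add_mk, Prod.mk.injEq]
    constructor
    · rintro (h | h | h | h | ⟨k, hk, h⟩)
      · exact Or.inl h
      · exact Or.inr ⟨0, by omega, by omega, by omega, by omega⟩
      · exact Or.inr ⟨0, by omega, by omega, by omega, by omega⟩
      · exact Or.inr ⟨0, by omega, by omega, by omega, by omega⟩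
      · exact Or.inr ⟨k + 1, by omega, by omega, by omega, by omega⟩
    · rintro (h | ⟨k, hk, h⟩)
      · exact Or.inl h
      · rcases k with _ | k
        · omega
        · exact Or.inr (Or.inr (Or.inr (Or.inr ⟨k, by omega, by omega, by omega, by omega⟩)))

/-- The top of the path in column `x` is at height `2x`, so the region is the triangle `0 ≤ y ≤ 2x ≤
2n`. -/
theorem mem_LRegion {q : ℤ × ℤ} :
    q ∈ LRegion n ↔ 0 ≤ q.2 ∧ q.2 ≤ 2 * q.1 ∧ q.1 ≤ n := by
  simp only [LRegion, latticePath, Set.mem_ofPred_eq, mem_scanl_abbWord]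
  constructor
  · rintro ⟨h, r, rfl | ⟨k, hk, h'⟩, h''⟩
    · simp only at h''
      omega
    · omega
  · rintro ⟨h₁, h₂, h₃⟩
    refine ⟨h₁, (q.1, 2 * q.1), ?_, rfl, h₂⟩
    by_cases h : q.1 = 0
    · exact Or.inl (by simp [h])
    · exact Or.inr ⟨(q.1 - 1).toNat, by omega, by simp only; omega, by simp only; omega,
        by simp only; omega⟩

theorem LCovers.le {q r : LRegion n} (h : LCovers q r) : q.1 ≤ r.1 := by
  rw [Prod.le_def]
  rcases h with h | h <;> omega

/-- Between comparable points there is a lattice path inside the region, so the generated order is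
the componentwise one. The induction is on the length of this path. -/
theorem reflTransGen_LCovers_iff {q r : LRegion n} :
    Relation.ReflTransGen LCovers q r ↔ q.1 ≤ r.1 := by
  constructor
  · intro h
    induction h with
    | refl => exact le_rfl
    | tail _ h ih => exact ih.trans h.le
  · intro h
    obtain ⟨d, hd⟩ : ∃ d : ℕ, (r.1.1 - q.1.1) + (r.1.2 - q.1.2) = d :=
      Int.eq_ofNat_of_zero_le (by have := Prod.le_def.1 h; omega)
    induction d generalizing q with
    | zero =>
      have h' := Prod.le_def.1 h
      obtain rfl : q = r := Subtype.ext (Prod.ext (by omega) (by omega))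
      exact .refl
    | succ d ih =>
      have h' := Prod.le_def.1 h
      have hq := mem_LRegion.1 q.2
      have hr := mem_LRegion.1 r.2
      -- Steps to the right come first, since they never leave `y ≤ 2x`; in the column of `r`,
      -- upward steps stay below `r`.
      by_cases h1 : q.1.1 < r.1.1
      · have hm : ((q.1.1 + 1, q.1.2) : ℤ × ℤ) ∈ LRegion n :=
          mem_LRegion.2 ⟨by simp only; omega, by simp only; omega, by simp only; omega⟩
        refine .head (b := ⟨_, hm⟩) (Or.inl ⟨rfl, rfl⟩) (ih (Prod.le_def.2 ⟨?_, ?_⟩) ?_) <;>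
          simp only <;> push_cast at hd <;> omega
      · have hm : ((q.1.1, q.1.2 + 1) : ℤ × ℤ) ∈ LRegion n :=
          mem_LRegion.2 ⟨by simp only; omega, by simp only; omega, by simp only; omega⟩
        refine .head (b := ⟨_, hm⟩) (Or.inr ⟨rfl, rfl⟩) (ih (Prod.le_def.2 ⟨?_, ?_⟩) ?_) <;>
          simp only <;> push_cast at hd <;> omega

/-- The first step of a path from `q` to `r` lands on a point strictly above `q`, which must be `r`
if nothing lies between. -/
theorem LCovers_of_lt_of_forall {q r : LRegion n} (hlt : q.1 < r.1)
    (h : ∀ x : LRegion n, q.1 < x.1 → ¬ x.1 < r.1) : LCovers q r := by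
  rcases (reflTransGen_LCovers_iff.2 hlt.le).cases_head with rfl | ⟨x, hx, hxr⟩
  · exact absurd hlt (lt_irrefl _)
  · have hqx : q.1 < x.1 := lt_of_le_of_ne hx.le fun h' => by
      rcases hx with hx | hx <;> rw [h'] at hx <;> omega
    have hle := reflTransGen_LCovers_iff.1 hxr
    obtain rfl : x = r := Subtype.ext (by_contra fun hne => h x hqx (lt_of_le_of_ne hle hne))
    exact hx

theorem LCovers.not_between {q r x : LRegion n} (h : LCovers q r) (h₁ : q.1 < x.1) :
    ¬ x.1 < r.1 := by
  intro h₂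
  rw [Prod.lt_iff] at h₁ h₂
  rcases h with h | h <;> omega

theorem LCovers.lt {q r : LRegion n} (h : LCovers q r) : q.1 < r.1 := by
  rw [Prod.lt_iff]
  rcases h with h | h <;> omega

/-! ### The expansion of the longest edge -/

/-- The indices of the terms. -/
def termIndices (n : ℕ) : Finset (Σ _ : ℕ, ℕ) :=
  (Finset.range (n + 1)).sigma fun k => Finset.range (2 * k + 1)

theorem mem_termIndices {q : Σ _ : ℕ, ℕ} : q ∈ termIndices n ↔ q.1 ≤ n ∧ q.2 ≤ 2 * q.1 := by
  simp only [termIndices, Finset.mem_sigma, Finset.mem_range, Nat.lt_succ_iff]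

/-- The sum of the first `n + 1` odd numbers. -/
theorem card_termIndices (n : ℕ) : (termIndices n).card = (n + 1) ^ 2 := by
  simp only [termIndices, Finset.card_sigma, Finset.card_range]
  induction n with
  | zero => simp
  | succ n ih => rw [Finset.sum_range_succ, ih]; ring

theorem termExp_inj {k m k' m' : ℕ} (hk : k ≤ n) (hm : m ≤ 2 * k) (hk' : k' ≤ n)
    (hm' : m' ≤ 2 * k') (h : termExp n k m = termExp n k' m') : k = k' ∧ m = m' := by
  have h1 := weight_termExp hk hm
  have h2 := weight_termExp hk' hm'
  rw [h] at h1
  omega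

/-- The exponents of the expansion of the longest edge. -/
def termSupport (n : ℕ) : Finset (Node n → ℤ) :=
  (termIndices n).image fun q => termExp n q.1 q.2

theorem termExp_injOn (n : ℕ) :
    Set.InjOn (fun q : Σ _ : ℕ, ℕ => termExp n q.1 q.2) (termIndices n) := by
  rintro ⟨k, m⟩ hq ⟨k', m'⟩ hq' h
  have h1 := mem_termIndices.1 hq
  have h2 := mem_termIndices.1 hq'
  obtain ⟨rfl, rfl⟩ := termExp_inj h1.1 h1.2 h2.1 h2.2 h
  rfl

/-- The expansion of the longest edge. -/
noncomputable def longestEdgeExpansion (n : ℕ) : (Node n → ℤ) →₀ ℤ :=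
  Finsupp.indicator (termSupport n) fun _ _ => 1

theorem longestEdgeExpansion_apply {m : Node n → ℤ} (hm : m ∈ termSupport n) :
    longestEdgeExpansion n m = 1 := Finsupp.indicator_of_mem hm _

theorem support_longestEdgeExpansion (n : ℕ) :
    (longestEdgeExpansion n).support = termSupport n := by
  refine Finset.Subset.antisymm (Finsupp.support_indicator_subset _ _) fun m hm => ?_
  rw [Finsupp.mem_support_iff, longestEdgeExpansion_apply hm]
  exact one_ne_zero

theorem isLaurentExpansion_longestEdge (n : ℕ) :
    IsLaurentExpansion (variableOf n (longestEdge n)) (longestEdgeExpansion n) := by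
  have h : ((longestEdgeExpansion n).sum fun m a => (a : Ambient n) * monomial m) =
      ∑ m ∈ termSupport n, monomial m := by
    rw [Finsupp.sum, support_longestEdgeExpansion]
    refine Finset.sum_congr rfl fun m hm => ?_
    rw [longestEdgeExpansion_apply hm, Int.cast_one, one_mul]
  rw [IsLaurentExpansion, h, variableOf_longestEdge, termSupport, Finset.sum_image (termExp_injOn n),
    termIndices, Finset.sum_sigma]

/-! ### Terms as lattice points -/

/-- The term at a lattice point. -/
def termAt (n : ℕ) (q : LRegion n) : Term (longestEdgeExpansion n) :=
  ⟨termExp n q.1.1.toNat q.1.2.toNat, by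
    have := mem_LRegion.1 q.2
    rw [support_longestEdgeExpansion]
    exact Finset.mem_image.2 ⟨⟨q.1.1.toNat, q.1.2.toNat⟩,
      mem_termIndices.2 ⟨by dsimp only; omega, by dsimp only; omega⟩, rfl⟩⟩

theorem termAt_val (q : LRegion n) :
    (termAt n q).1 = termExp n q.1.1.toNat q.1.2.toNat := rfl

theorem weight_termAt (q : LRegion n) :
    weight weightFst (termAt n q).1 = 2 * q.1.1 - n ∧ weight weightSnd (termAt n q).1 = q.1.2 := by
  have := mem_LRegion.1 q.2
  have h := weight_termExp (n := n) (k := q.1.1.toNat) (m := q.1.2.toNat) (by omega) (by omega)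
  rw [termAt_val]
  omega

theorem termAt_bijective (n : ℕ) : Function.Bijective (termAt n) := by
  constructor
  · intro q r h
    have h1 := weight_termAt q
    have h2 := weight_termAt r
    rw [h] at h1
    exact Subtype.ext (Prod.ext (by omega) (by omega))
  · rintro ⟨m, hm⟩
    have hm' := hm
    rw [support_longestEdgeExpansion] at hm'
    obtain ⟨⟨k, l⟩, hq, rfl⟩ := Finset.mem_image.1 hm'
    rw [mem_termIndices] at hq
    refine ⟨⟨(k, l), mem_LRegion.2 ?_⟩, Subtype.ext ?_⟩
    · simp only at hq ⊢
      omega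
    · simp [termAt]

theorem yStep_iff (ε : ℤˣ) {c : (Node n → ℤ) →₀ ℤ} (m m' : Term c) :
    YStep ε m m' ↔ ∃ u : Node n, ¬ IsFrozen u.1 ∧ m'.1 = m.1 + yExp u := by
  simp only [YStep, units_mul_yHat, funext_iff, Pi.add_apply]

/-- A `ŷ`-step changes the weights, hence the lattice point, by one unit step. Conversely,
neighbouring lattice points have terms that differ by an explicit `ŷ`. -/
theorem yStep_termAt (ε : ℤˣ) (q r : LRegion n) :
    YStep ε (termAt n q) (termAt n r) ↔ LCovers q r := by
  rw [yStep_iff]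
  have hq := mem_LRegion.1 q.2
  have hr := mem_LRegion.1 r.2
  constructor
  · rintro ⟨u, hu, h⟩
    have h1 := weight_termAt q
    have h2 := weight_termAt r
    rw [h, weight_add, weight_add] at h2
    have h3 := weight_yExp hu
    unfold LCovers
    omega
  · rintro (⟨h1, h2⟩ | ⟨h1, h2⟩)
    · obtain ⟨u, hu, h⟩ := termExp_succ_left (n := n) (k := q.1.1.toNat) (by omega) q.1.2.toNat
      refine ⟨u, hu, ?_⟩
      rw [termAt_val, termAt_val, ← h, h1, h2, show (q.1.1 + 1).toNat = q.1.1.toNat + 1 by omega]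
    · obtain ⟨u, hu, h⟩ := termExp_succ_right (n := n) (k := q.1.1.toNat) (m := q.1.2.toNat)
        (by omega) (by omega)
      refine ⟨u, hu, ?_⟩
      rw [termAt_val, termAt_val, ← h, h1, h2, show (q.1.2 + 1).toNat = q.1.2.toNat + 1 by omega]

/-- The terms of the expansion correspond to lattice points. -/
noncomputable def termEquiv (n : ℕ) : Term (longestEdgeExpansion n) ≃ LRegion n :=
  (Equiv.ofBijective _ (termAt_bijective n)).symm

theorem termAt_termEquiv (m : Term (longestEdgeExpansion n)) : termAt n (termEquiv n m) = m :=
  (Equiv.ofBijective _ (termAt_bijective n)).apply_symm_apply m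

theorem termEquiv_termAt (q : LRegion n) : termEquiv n (termAt n q) = q :=
  (Equiv.ofBijective _ (termAt_bijective n)).symm_apply_apply q

theorem yStep_iff_LCovers (ε : ℤˣ) (m m' : Term (longestEdgeExpansion n)) :
    YStep ε m m' ↔ LCovers (termEquiv n m) (termEquiv n m') := by
  rw [← yStep_termAt ε, termAt_termEquiv, termAt_termEquiv]

theorem reflTransGen_yStep_iff (ε : ℤˣ) (m m' : Term (longestEdgeExpansion n)) :
    Relation.ReflTransGen (YStep ε) m m' ↔
      Relation.ReflTransGen LCovers (termEquiv n m) (termEquiv n m') := by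
  constructor
  · exact fun h => h.lift _ fun a b => (yStep_iff_LCovers ε a b).1
  · intro h
    rw [← termAt_termEquiv m, ← termAt_termEquiv m']
    exact h.lift _ fun a b => (yStep_termAt ε a b).2

/-- The expansion poset. -/
@[reducible] noncomputable def expansionPoset (n : ℕ) :
    PartialOrder (Term (longestEdgeExpansion n)) :=
  PartialOrder.lift (fun m => (termEquiv n m).1)
    (Subtype.val_injective.comp (termEquiv n).injective)

end SL3Fan

/-! ### The proposition -/

theorem mainTheorem9 (n : ℕ) (hn : 1 ≤ n) (ε : ℤˣ) :
    -- exactly one variable `z = x_γ` is attached to the longest edge `γ = i → j`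
    ∃ z : Ambient n, (∀ w, IsVariableOf ε (longestEdge n) w ↔ w = z) ∧
    -- it has exactly one Laurent expansion
    ∃ c : (Node n → ℤ) →₀ ℤ, (∀ c', IsLaurentExpansion z c' ↔ c' = c) ∧
      -- (a) the expansion has `(n + 1)²` terms, and all coefficients are one
      c.support.card = (n + 1) ^ 2 ∧ (∀ m ∈ c.support, c m = 1) ∧
      -- the terms form a poset whose covering relations are the multiplications by `ŷ`
      ∃ _P : PartialOrder (Term c),
        (∀ m m' : Term c, m ≤ m' ↔ Relation.ReflTransGen (YStep ε) m m') ∧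
        (∀ m m' : Term c, m ⋖ m' ↔ YStep ε m m') ∧
        -- (b) the minimal element is the path `i, p₁, f, j`
        (∃ m₀ : Term c, (∀ m, m₀ ≤ m) ∧
          m₀.1 = threeEdgePath (p 0) (p 1) (fanVertex n) (p (Fin.last (n + 1)))) ∧
        -- (c) the maximal element is the path `i, f, pₙ, j`
        (∃ m₁ : Term c, (∀ m, m ≤ m₁) ∧
          m₁.1 = threeEdgePath (p 0) (fanVertex n) (p (Fin.last n).castSucc)
            (p (Fin.last (n + 1)))) ∧
        -- (d) the poset is isomorphic to `L_γ`
        ∃ e : Term c ≃ LRegion n,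
          (∀ m m', m ⋖ m' ↔ LCovers (e m) (e m')) ∧
          (∀ m m', m ≤ m' ↔ Relation.ReflTransGen LCovers (e m) (e m')) := by
  refine ⟨variableOf n (longestEdge n), isVariableOf_longestEdge_iff ε, longestEdgeExpansion n,
    fun c' => ⟨fun h => h.unique (isLaurentExpansion_longestEdge n), ?_⟩, ?_, ?_,
    expansionPoset n, ?_⟩
  · rintro rfl
    exact isLaurentExpansion_longestEdge n
  · rw [support_longestEdgeExpansion, termSupport, Finset.card_image_of_injOn (termExp_injOn n),
      card_termIndices]
  · intro m hm
    rw [support_longestEdgeExpansion] at hm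
    exact longestEdgeExpansion_apply hm
  let := expansionPoset n
  have hle : ∀ m m' : Term (longestEdgeExpansion n),
      m ≤ m' ↔ Relation.ReflTransGen LCovers (termEquiv n m) (termEquiv n m') :=
    fun m m' => reflTransGen_LCovers_iff.symm
  have hlt : ∀ m m' : Term (longestEdgeExpansion n),
      m < m' ↔ (termEquiv n m).1 < (termEquiv n m').1 := fun _ _ => Iff.rfl
  have hcov : ∀ m m' : Term (longestEdgeExpansion n),
      m ⋖ m' ↔ LCovers (termEquiv n m) (termEquiv n m') := by
    intro m m'
    constructor
    · intro h
      refine LCovers_of_lt_of_forall ((hlt _ _).1 h.1) fun x h₁ h₂ => ?_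
      rw [← termEquiv_termAt x] at h₁ h₂
      exact h.2 ((hlt _ _).2 h₁) ((hlt _ _).2 h₂)
    · exact fun h => ⟨(hlt _ _).2 h.lt, fun x h₁ h₂ =>
        h.not_between ((hlt _ _).1 h₁) ((hlt _ _).1 h₂)⟩
  refine ⟨fun m m' => (hle m m').trans (reflTransGen_yStep_iff ε m m').symm,
    fun m m' => (hcov m m').trans (yStep_iff_LCovers ε m m').symm, ?_, ?_,
    termEquiv n, hcov, hle⟩
  -- The lower left corner of the triangle lies componentwise below all its points; the corner `(n,
  -- 2n)` used next lies above them.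
  · refine ⟨termAt n ⟨(0, 0), mem_LRegion.2 (by simp)⟩, fun m => ?_, termExp_zero_zero n⟩
    rw [hle, reflTransGen_LCovers_iff, termEquiv_termAt]
    have := mem_LRegion.1 (termEquiv n m).2
    exact Prod.le_def.2 ⟨by simp only; omega, by simp only; omega⟩
  · refine ⟨termAt n ⟨(n, 2 * n), mem_LRegion.2 (by simp)⟩, fun m => ?_, ?_⟩
    · rw [hle, reflTransGen_LCovers_iff, termEquiv_termAt]
      have := mem_LRegion.1 (termEquiv n m).2
      exact Prod.le_def.2 ⟨by simp only; omega, by simp only; omega⟩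
    · rw [← termExp_last n]
      change termExp n (n : ℤ).toNat (2 * n : ℤ).toNat = _
      rw [Int.toNat_natCast, show (2 * n : ℤ).toNat = 2 * n by omega]
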